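/- Let $k$ be a field, $n\in\mathbb N$, and let $\operatorname{rep}_k A_n$ be the abelian category of finite-dimensional representations of the equioriented quiver $A_n\colon 1\to 2\to\cdots\to n$. For an integer $\delta\ge 0$ let $M(\delta)$ be the $\delta$-shift of a representation $M$, i.e. $M(\delta)_x=M_{x+\delta}$ if $x+\delta\le n$ and $0$ otherwise, and let $\phi_M^{\delta}\colon M\to M(\delta)$ be given by the structure maps $M_x\to M_{x+\delta}$ of $M$. A $\delta$-interleaving pair between $M$ and $N$ consists of morphisms $f\colon M\to N(\delta)$ and $g\colon N\to M(\delta)$ with $g(\delta)\circ f=\phi_M^{2\delta}$ and $f(\delta)\circ g=\phi_N^{2\delta}$. The exact functor $(\delta)$ acts termwise on $D^b(\operatorname{rep}_k A_n)$, and $H^i(Y(\delta))=H^i(Y)(\delta)$. Objects $X,Y$ of $D^b(\operatorname{rep}_k A_n)$ are derived $\delta$-interleaved if there are morphisms $f\colon X\to Y(\delta)$ and $g\colon Y\to X(\delta)$ in $D^b(\operatorname{rep}_k A_n)$ such that $(H^i(f),H^i(g))$ is a $\delta$-interleaving pair between $H^i(X)$ and $H^i(Y)$ for every $i\in\mathbb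 Z$. The barcode $\mathcal B(M)$ of a representation $M$ is the multiset of intervals $\langle b,d\rangle$, $1\le b\le d\le n$, occurring in the decomposition $M\cong\bigoplus_{b\le d}\mathbb I[b,d]^{m(b,d)}$ into interval representations. Two barcodes $\mathcal B,\mathcal B'$ are $\delta$-matched if there is a bijection $\sigma$ from a subset of $\mathcal B$ to a subset of $\mathcal B'$ such that every interval $\langle b,d\rangle$ with $d-b\ge 2\delta$ of $\mathcal B$ (resp. of $\mathcal B'$) lies in the domain (resp. the image) of $\sigma$, and $\sigma\langle b,d\rangle=\langle b',d'\rangle$ implies $b'-\delta\le b$, $d\le d'+\delta$, $b-\delta\le b'$ and $d'\le d+\delta$. The derived barcode of $X\in D^b(\operatorname{rep}_k A_n)$ is the disjoint union $\mathcal B^D(X)=\bigsqcup_{i}\mathcal B(H^i(X))$; two derived barcodes $\mathcal B^D(X),\mathcal B^D(Y)$ are $\delta$-matched if $\mathcal B(H^i(X))$ and $\mathcal B(H^i(Y))$ are $\delta$-matched for all $i\in\mathbb Z$. Let $\mathcal A$ be an abelian category and $E\colon D^b(\mathcal A)\to D^b(\operatorname{rep}_k A_n)$ an equivalence of triangulated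 categories. For $X,Y\in D^b(\mathcal A)$ let $d_I^{E,\mathcal A}(X,Y)\in[0,\infty]$ be the infimum of the integers $\delta\ge 0$ such that $E(X)$ and $E(Y)$ are derived $\delta$-interleaved, and let $d_B^{E,\mathcal A}(\mathcal B^D_{\mathcal A}(X),\mathcal B^D_{\mathcal A}(Y))\in[0,\infty]$ be the infimum of the integers $\delta\ge 0$ such that $\mathcal B^D(E(X))$ and $\mathcal B^D(E(Y))$ are $\delta$-matched. (Here $\mathcal B^D_{\mathcal A}(X)$ is the multiset of indecomposable direct summands of $X$, which $E$ identifies with $\mathcal B^D(E(X))$.) For $X,Y\in\mathcal A$ these distances are those of the stalk complexes $X[0],Y[0]$. Then $$d_B^{E,\mathcal A}(\mathcal B^D_{\mathcal A}(X),\mathcal B^D_{\mathcal A}(Y))=d_I^{E,\mathcal A}(X,Y)$$ for all $X,Y$ in $D^b(\mathcal A)$, and hence for all $X,Y$ in $\mathcal A$. -/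

import Mathlib

open CategoryTheory CategoryTheory.Limits
open scoped ENNReal

namespace DerivedPersistence

universe w₁ w₂ v₁ v₂ u₁ u₂ u

/-! ### Persistence modules and the `δ`-shift functor -/

section Shift

variable {C : Type u₁} [Category.{v₁} C] [HasZeroObject C] {n : ℕ}

open scoped ZeroObject

/-- The value at `x : ℕ` of the extension by zero of `M : Fin n ⥤ C`. -/
noncomputable def extendObj (M : Fin n ⥤ C) (x : ℕ) : C :=
  if h : x < n then M.obj ⟨x, h⟩ else 0

/-- Inside the range `x < n` the extension by zero is `M`. -/
noncomputable def extendObjIso (M : Fin n ⥤ C) (x : ℕ) (h : x < n) :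
    extendObj M x ≅ M.obj ⟨x, h⟩ :=
  eqToIso (dif_pos h)

/-- Outside the range `x < n` the extension by zero is zero. -/
lemma isZero_extendObj (M : Fin n ⥤ C) (x : ℕ) (h : ¬ x < n) : IsZero (extendObj M x) := by
  unfold extendObj
  rw [dif_neg h]
  exact isZero_zero C

variable [HasZeroMorphisms C]

/-- The structure maps of the extension by zero. -/
noncomputable def extendMap (M : Fin n ⥤ C) {x y : ℕ} (hxy : x ≤ y) :
    extendObj M x ⟶ extendObj M y :=
  if h : y < n then
    (extendObjIso M x (hxy.trans_lt h)).hom ≫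
      M.map (homOfLE (show (⟨x, hxy.trans_lt h⟩ : Fin n) ≤ ⟨y, h⟩ from hxy)) ≫
        (extendObjIso M y h).inv
  else 0

/-- The extension by zero of a morphism. -/
noncomputable def extendHom {M N : Fin n ⥤ C} (f : M ⟶ N) (x : ℕ) :
    extendObj M x ⟶ extendObj N x :=
  if h : x < n then
    (extendObjIso M x h).hom ≫ f.app ⟨x, h⟩ ≫ (extendObjIso N x h).inv
  else 0

lemma extendMap_refl (M : Fin n ⥤ C) (x : ℕ) : extendMap M (le_refl x) = 𝟙 _ := by
  by_cases h : x < n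
  · simp [extendMap, h]
  · exact (isZero_extendObj M x h).eq_of_src _ _

lemma extendMap_trans (M : Fin n ⥤ C) {x y z : ℕ} (hxy : x ≤ y) (hyz : y ≤ z) :
    extendMap M hxy ≫ extendMap M hyz = extendMap M (hxy.trans hyz) := by
  by_cases h : z < n
  · simp [extendMap, h, hyz.trans_lt h, ← Functor.map_comp_assoc]
  · exact (isZero_extendObj M z h).eq_of_tgt _ _

lemma extendHom_naturality {M N : Fin n ⥤ C} (f : M ⟶ N) {x y : ℕ} (hxy : x ≤ y) :
    extendMap M hxy ≫ extendHom f y = extendHom f x ≫ extendMap N hxy := by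
  by_cases h : y < n
  · simp [extendMap, extendHom, h, hxy.trans_lt h]
  · exact (isZero_extendObj N y h).eq_of_tgt _ _

lemma extendHom_id (M : Fin n ⥤ C) (x : ℕ) : extendHom (𝟙 M) x = 𝟙 _ := by
  by_cases h : x < n
  · simp [extendHom, h]
  · exact (isZero_extendObj M x h).eq_of_src _ _

lemma extendHom_comp {M N L : Fin n ⥤ C} (f : M ⟶ N) (g : N ⟶ L) (x : ℕ) :
    extendHom (f ≫ g) x = extendHom f x ≫ extendHom g x := by
  by_cases h : x < n
  · simp [extendHom, h]
  · exact (isZero_extendObj M x h).eq_of_src _ _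

/-- The `δ`-shift `M(δ)` of `M`, for `δ ≥ 0`: `M(δ)_x = M_{x+δ}`, with the structure maps
of `M`, as long as `x + δ` is a vertex of `A_n`, and zero otherwise. -/
noncomputable abbrev shiftObj (δ : ℕ) (M : Fin n ⥤ C) : Fin n ⥤ C where
  obj x := extendObj M (x + δ)
  map {x y} e := extendMap M (Nat.add_le_add_right (show (x : ℕ) ≤ y from leOfHom e) δ)
  map_id _ := extendMap_refl M _
  map_comp _ _ := (extendMap_trans M _ _).symm

/-- The `δ`-shift functor `M ↦ M(δ)`. -/
@[simps]
noncomputable def shift (n δ : ℕ) : (Fin n ⥤ C) ⥤ (Fin n ⥤ C) where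
  obj M := shiftObj δ M
  map f :=
    { app := fun x => extendHom f (x + δ)
      naturality := fun x y e =>
        extendHom_naturality f (Nat.add_le_add_right (show (x : ℕ) ≤ y from leOfHom e) δ) }
  map_id M := by
    ext x
    exact extendHom_id M _
  map_comp f g := by
    ext x
    exact extendHom_comp f g _

/-- The transition morphism `φ_M^δ : M ⟶ M(δ)`, given at `x` by the structure map
`M_x ⟶ M_{x+δ}` (zero if `x + δ` is not a vertex of `A_n`). -/
noncomputable def transition (δ : ℕ) (M : Fin n ⥤ C) : M ⟶ shiftObj δ M where
  app x := (extendObjIso M x x.2).inv ≫ extendMap M (Nat.le_add_right (x : ℕ) δ)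
  naturality x y e := by
    have hxy : (x : ℕ) ≤ y := leOfHom e
    have h1 : M.map e ≫ (extendObjIso M y y.2).inv =
        (extendObjIso M x x.2).inv ≫ extendMap M hxy := by
      simp only [extendMap, y.2, dif_pos, Iso.inv_hom_id_assoc]
      rfl
    rw [← Category.assoc, h1, Category.assoc, Category.assoc, extendMap_trans, extendMap_trans]

/-- The canonical identification `M(δ)(δ) ≅ M(2δ)`; at a vertex `x` with `x + 2δ` a vertex it is
the identity of `M_{x+2δ}`, elsewhere both sides vanish. -/
noncomputable def shiftShiftIso (δ : ℕ) (M : Fin n ⥤ C) :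
    shiftObj δ (shiftObj δ M) ≅ shiftObj (2 * δ) M :=
  NatIso.ofComponents
    (fun x =>
      if h : (x : ℕ) + δ < n then
        extendObjIso (shiftObj δ M) _ h ≪≫
          eqToIso (congrArg (extendObj M) (show (x : ℕ) + δ + δ = x + 2 * δ by omega))
      else
        IsZero.iso (isZero_extendObj _ _ h) (isZero_extendObj _ _ (by omega)))
    (by
      intro x y e
      have hxy : (x : ℕ) ≤ y := leOfHom e
      have key : ∀ {a b a' b' : ℕ} (hab : a ≤ b) (ha : a = a') (hb : b = b'),
          extendMap M hab ≫ eqToHom (congrArg (extendObj M) hb) =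
            eqToHom (congrArg (extendObj M) ha) ≫
              extendMap M (show a' ≤ b' by omega) := by
        rintro a b _ _ hab rfl rfl
        simp
      by_cases h : (y : ℕ) + δ < n
      · have hx : (x : ℕ) + δ < n := by omega
        simp only [h, hx, dif_pos, Iso.trans_hom, eqToIso.hom]
        change extendMap (shiftObj δ M) _ ≫ _ ≫ _ = (_ ≫ _) ≫ extendMap M _
        simp only [extendMap, h, dif_pos, Category.assoc, Iso.inv_hom_id_assoc]
        congr 1
        exact key (show (x : ℕ) + δ + δ ≤ y + δ + δ by omega) (by omega) (by omega)
      · exact (isZero_extendObj M (y + 2 * δ) (by omega)).eq_of_tgt _ _)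

/-- Evaluating `M(δ)` at `x` is evaluating `M` at `x + δ` if this is a vertex. -/
noncomputable def shiftCompEvaluationIso (δ : ℕ) (x : Fin n) (h : (x : ℕ) + δ < n) :
    shift n δ ⋙ (evaluation (Fin n) C).obj x ≅ (evaluation (Fin n) C).obj ⟨x + δ, h⟩ :=
  NatIso.ofComponents (fun M => extendObjIso M _ h) (by
    intro M N f
    change extendHom f _ ≫ _ = _
    simp only [extendHom, h, dif_pos, Category.assoc, Iso.inv_hom_id, Category.comp_id]
    rfl)

lemma isZero_shift_comp_evaluation (δ : ℕ) (x : Fin n) (h : ¬ (x : ℕ) + δ < n) :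
    IsZero (shift n δ ⋙ (evaluation (Fin n) C).obj x) := by
  rw [Functor.isZero_iff]
  exact fun M => isZero_extendObj M _ h

end Shift

section ShiftExact

variable {C : Type u₁} [Category.{v₁} C] [Abelian C] {n : ℕ}

instance (δ : ℕ) : (shift (C := C) n δ).Additive where
  map_add := by
    intro M N f g
    ext x
    change extendHom (f + g) _ = extendHom f _ + extendHom g _
    by_cases h : (x : ℕ) + δ < n
    · simp only [extendHom, h, dif_pos, NatTrans.app_add, Preadditive.add_comp,
        Preadditive.comp_add]
      rfl
    · exact (isZero_extendObj M _ h).eq_of_src _ _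

instance (δ : ℕ) : PreservesFiniteLimits (shift (C := C) n δ) :=
  preservesFiniteLimits_of_evaluation _ fun x => by
    by_cases h : (x : ℕ) + δ < n
    · exact preservesFiniteLimits_of_natIso (shiftCompEvaluationIso δ x h).symm
    · exact ⟨fun J _ _ =>
        Functor.preservesLimitsOfShape_of_isZero _ (isZero_shift_comp_evaluation δ x h) J⟩

instance (δ : ℕ) : PreservesFiniteColimits (shift (C := C) n δ) :=
  preservesFiniteColimits_of_evaluation _ fun x => by
    by_cases h : (x : ℕ) + δ < n
    · exact preservesFiniteColimits_of_natIso (shiftCompEvaluationIso δ x h).symm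
    · exact ⟨fun J _ _ =>
        Functor.preservesColimitsOfShape_of_isZero _ (isZero_shift_comp_evaluation δ x h) J⟩

/-- `(f, g)` is a `δ`-interleaving pair between `M` and `N`. -/
def IsInterleavingPair (δ : ℕ) {M N : Fin n ⥤ C}
    (f : M ⟶ (shift n δ).obj N) (g : N ⟶ (shift n δ).obj M) : Prop :=
  f ≫ (shift n δ).map g ≫ (shiftShiftIso δ M).hom = transition (2 * δ) M ∧
    g ≫ (shift n δ).map f ≫ (shiftShiftIso δ N).hom = transition (2 * δ) N

end ShiftExact

/-! ### Cohomology and exact functors on bounded derived categories -/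

section Bounded

open DerivedCategory DerivedCategory.TStructure

variable {C : Type u₁} [Category.{v₁} C] [Abelian C] [HasDerivedCategory.{w₁} C]
  {D : Type u₂} [Category.{v₂} D] [Abelian D] [HasDerivedCategory.{w₂} D]

/-- The `i`-th cohomology functor `H^i` on the bounded derived category. -/
noncomputable def cohomology (C : Type u₁) [Category.{v₁} C] [Abelian C]
    [HasDerivedCategory.{w₁} C] (i : ℤ) : DerivedCategory.Bounded C ⥤ C :=
  Bounded.ι ⋙ homologyFunctor C i

/-- The embedding of an abelian category in its bounded derived category, which sends `X` to the
stalk complex `X[0]` concentrated in degree `0`. -/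
noncomputable def stalk (C : Type u₁) [Category.{v₁} C] [Abelian C]
    [HasDerivedCategory.{w₁} C] : C ⥤ DerivedCategory.Bounded C :=
  t.bounded.lift (singleFunctor C 0) fun X =>
    ⟨⟨0, (inferInstance : ((singleFunctor C 0).obj X).IsGE 0)⟩,
      ⟨0, (inferInstance : ((singleFunctor C 0).obj X).IsLE 0)⟩⟩

lemma bounded_mapDerivedCategory (F : C ⥤ D) [F.Additive] [PreservesFiniteLimits F]
    [PreservesFiniteColimits F] (X : DerivedCategory.Bounded C) :
    (t : Triangulated.TStructure (DerivedCategory D)).bounded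
      (F.mapDerivedCategory.obj X.obj) := by
  obtain ⟨⟨a, ⟨K, e, hK⟩⟩, ⟨b, ⟨L, e', hL⟩⟩⟩ := X.property
  refine ⟨⟨a, ⟨_, F.mapDerivedCategory.mapIso e ≪≫ F.mapDerivedCategoryFactors.app K, ?_⟩⟩,
    ⟨b, ⟨_, F.mapDerivedCategory.mapIso e' ≪≫ F.mapDerivedCategoryFactors.app L, ?_⟩⟩⟩
  · rw [CochainComplex.isStrictlyGE_iff]
    exact fun i hi => F.map_isZero (K.isZero_of_isStrictlyGE a i hi)
  · rw [CochainComplex.isStrictlyLE_iff]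
    exact fun i hi => F.map_isZero (L.isZero_of_isStrictlyLE b i hi)

/-- The functor between bounded derived categories which an exact functor induces by termwise
application to complexes. -/
noncomputable def mapBounded (F : C ⥤ D) [F.Additive] [PreservesFiniteLimits F]
    [PreservesFiniteColimits F] : DerivedCategory.Bounded C ⥤ DerivedCategory.Bounded D :=
  t.bounded.lift (Bounded.ι ⋙ F.mapDerivedCategory) (bounded_mapDerivedCategory F)

/-- For complexes: the canonical identification of `H^i ∘ F` with `F ∘ H^i`, for `F` exact. -/
noncomputable def homologyMapComplexIso (F : C ⥤ D) [F.Additive] [PreservesFiniteLimits F]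
    [PreservesFiniteColimits F] (i : ℤ) :
    F.mapHomologicalComplex (ComplexShape.up ℤ) ⋙
        HomologicalComplex.homologyFunctor D (ComplexShape.up ℤ) i ≅
      HomologicalComplex.homologyFunctor C (ComplexShape.up ℤ) i ⋙ F :=
  NatIso.ofComponents (fun K => (K.sc i).mapHomologyIso F) fun f =>
    ShortComplex.mapHomologyIso_hom_naturality
      ((HomologicalComplex.shortComplexFunctor C (ComplexShape.up ℤ) i).map f) F

/-- The canonical identification of `H^i ∘ F` with `F ∘ H^i` on the derived category, for `F`
exact: the natural isomorphism induced by the one for complexes. -/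
noncomputable def homologyMapDerivedIso (F : C ⥤ D) [F.Additive] [PreservesFiniteLimits F]
    [PreservesFiniteColimits F] (i : ℤ) :
    F.mapDerivedCategory ⋙ homologyFunctor D i ≅ homologyFunctor C i ⋙ F :=
  letI : Localization.Lifting DerivedCategory.Q
      (HomologicalComplex.quasiIso C (ComplexShape.up ℤ))
      (F.mapHomologicalComplex (ComplexShape.up ℤ) ⋙
        HomologicalComplex.homologyFunctor D (ComplexShape.up ℤ) i)
      (F.mapDerivedCategory ⋙ homologyFunctor D i) :=
    ⟨(Functor.associator _ _ _).symm ≪≫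
      Functor.isoWhiskerRight F.mapDerivedCategoryFactors _ ≪≫ Functor.associator _ _ _ ≪≫
        Functor.isoWhiskerLeft _ (homologyFunctorFactors D i)⟩
  letI : Localization.Lifting DerivedCategory.Q
      (HomologicalComplex.quasiIso C (ComplexShape.up ℤ))
      (HomologicalComplex.homologyFunctor C (ComplexShape.up ℤ) i ⋙ F)
      (homologyFunctor C i ⋙ F) :=
    ⟨(Functor.associator _ _ _).symm ≪≫
      Functor.isoWhiskerRight (homologyFunctorFactors C i) F⟩
  Localization.liftNatIso DerivedCategory.Q
    (HomologicalComplex.quasiIso C (ComplexShape.up ℤ)) _ _ _ _ (homologyMapComplexIso F i)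

/-- For `f : X ⟶ F(Y)` in the bounded derived category, with `F` exact, the morphism
`H^i(f) : H^i(X) ⟶ H^i(F(Y)) = F(H^i(Y))`. -/
noncomputable def cohomologyMap (F : C ⥤ D) [F.Additive] [PreservesFiniteLimits F]
    [PreservesFiniteColimits F] {X : DerivedCategory.Bounded D} {Y : DerivedCategory.Bounded C}
    (f : X ⟶ (mapBounded F).obj Y) (i : ℤ) :
    (cohomology D i).obj X ⟶ F.obj ((cohomology C i).obj Y) :=
  (cohomology D i).map f ≫ (homologyMapDerivedIso F i).hom.app Y.obj

end Bounded

/-! ### Derived interleavings -/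

/-- The category `rep_k A_n` of finite-dimensional representations of the equioriented quiver
`1 → 2 → ⋯ → n`: functors to finite-dimensional vector spaces from its path category, which is
the poset `Fin n` (the vertex `x + 1` is `x : Fin n`). -/
abbrev Rep (k : Type u) [Field k] (n : ℕ) : Type (u + 1) := Fin n ⥤ FGModuleCat.{u} k

instance (k : Type u) [Field k] (n : ℕ) : HasFiniteBiproducts (Rep k n) :=
  Abelian.hasFiniteBiproducts

section Interleaving

variable {k : Type u} [Field k] {n : ℕ} [HasDerivedCategory.{w₁} (Rep k n)]

/-- Derived `δ`-interleaved objects of `D^b(rep_k A_n)`. -/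
def IsDerivedInterleaved (δ : ℕ) (X Y : DerivedCategory.Bounded (Rep k n)) : Prop :=
  ∃ (f : X ⟶ (mapBounded (shift n δ)).obj Y) (g : Y ⟶ (mapBounded (shift n δ)).obj X),
    ∀ i : ℤ, IsInterleavingPair δ (cohomologyMap (shift n δ) f i) (cohomologyMap (shift n δ) g i)

/-- The derived interleaving distance on `D^b(rep_k A_n)`. -/
noncomputable def derivedInterleavingDist (X Y : DerivedCategory.Bounded (Rep k n)) : ℝ≥0∞ :=
  ⨅ (δ : ℕ) (_ : IsDerivedInterleaved δ X Y), (δ : ℝ≥0∞)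

end Interleaving

/-! ### Barcodes and bottleneck distances -/

/-- The intervals `[b, d]` of vertices of `A_n`, as pairs `(b, d)` with `b ≤ d`. -/
abbrev Interval (n : ℕ) : Type := {p : Fin n × Fin n // p.1 ≤ p.2}

/-- The left end of an interval (vertices are counted from `1`). -/
def Interval.birth {n : ℕ} (I : Interval n) : ℤ := (I.1.1 : ℕ) + 1

/-- The right end of an interval (vertices are counted from `1`). -/
def Interval.death {n : ℕ} (I : Interval n) : ℤ := (I.1.2 : ℕ) + 1

open scoped ZeroObject in
/-- The interval representation `𝕀[b,d]`: it is `k` at the vertices in `[b,d]` and `0` elsewhere;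
the maps inside `[b,d]` are identities and all others are zero. -/
noncomputable def intervalRep (k : Type u) [Field k] {n : ℕ} (I : Interval n) : Rep k n where
  obj x := if I.1.1 ≤ x ∧ x ≤ I.1.2 then FGModuleCat.of k k else 0
  map {x y} _ :=
    if h : (I.1.1 ≤ x ∧ x ≤ I.1.2) ∧ (I.1.1 ≤ y ∧ y ≤ I.1.2) then
      eqToHom ((if_pos h.1).trans (if_pos h.2).symm)
    else 0
  map_id x := by
    by_cases h : I.1.1 ≤ x ∧ x ≤ I.1.2
    · rw [dif_pos ⟨h, h⟩, eqToHom_refl]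
    · refine IsZero.eq_of_src ?_ _ _
      rw [if_neg h]
      exact isZero_zero _
  map_comp {x y z} e f := by
    have hxy := leOfHom e
    have hyz := leOfHom f
    by_cases h : (I.1.1 ≤ x ∧ x ≤ I.1.2) ∧ (I.1.1 ≤ z ∧ z ≤ I.1.2)
    · have hy : I.1.1 ≤ y ∧ y ≤ I.1.2 := ⟨h.1.1.trans hxy, hyz.trans h.2.2⟩
      rw [dif_pos h, dif_pos ⟨h.1, hy⟩, dif_pos ⟨hy, h.2⟩, eqToHom_trans]
    · by_cases hx : I.1.1 ≤ x ∧ x ≤ I.1.2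
      · refine IsZero.eq_of_tgt ?_ _ _
        rw [if_neg fun hz => h ⟨hx, hz⟩]
        exact isZero_zero _
      · refine IsZero.eq_of_src ?_ _ _
        rw [if_neg hx]
        exact isZero_zero _

/-- A barcode: a finite multiset of intervals, given by its multiplicities. -/
abbrev Barcode (n : ℕ) : Type := Interval n → ℕ

/-- The elements `⟨b, d⟩ = (b, d, m)` of a barcode, each interval being repeated according to its
multiplicity. -/
abbrev Barcode.Bar {n : ℕ} (B : Barcode n) : Type := Σ I : Interval n, Fin (B I)

/-- `B` lists the multiplicities of an interval decomposition `M ≅ ⨁ 𝕀[b,d]^{m(b,d)}`. -/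
def IsBarcode {k : Type u} [Field k] {n : ℕ} (M : Rep k n) (B : Barcode n) : Prop :=
  Nonempty (M ≅ ⨁ fun s : B.Bar => intervalRep k s.1)

open Classical in
/-- The barcode of a representation of `A_n`: the multiplicities in an interval decomposition
(one always exists and its multiplicities are unique, so the `else` branch is never reached). -/
noncomputable def barcode {k : Type u} [Field k] {n : ℕ} (M : Rep k n) : Barcode n :=
  if h : ∃ B : Barcode n, IsBarcode M B then h.choose else 0

/-- The matching `σ` (a bijection between a subset `Coim σ` of `B` and a subset `Im σ` of `B'`)
is a `δ`-matching of barcodes. -/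
structure IsMatching {n : ℕ} (δ : ℕ) (B B' : Barcode n) (σ : B.Bar ≃. B'.Bar) : Prop where
  coim : ∀ s : B.Bar, 2 * (δ : ℤ) ≤ s.1.death - s.1.birth → ∃ s', s' ∈ σ s
  im : ∀ s' : B'.Bar, 2 * (δ : ℤ) ≤ s'.1.death - s'.1.birth → ∃ s, s' ∈ σ s
  close : ∀ s s', s' ∈ σ s →
    (s'.1.birth - δ ≤ s.1.birth ∧ s.1.death ≤ s'.1.death + δ) ∧
      (s.1.birth - δ ≤ s'.1.birth ∧ s'.1.death ≤ s.1.death + δ)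

/-- Two barcodes are `δ`-matched. -/
def IsMatched {n : ℕ} (δ : ℕ) (B B' : Barcode n) : Prop :=
  ∃ σ : B.Bar ≃. B'.Bar, IsMatching δ B B' σ

/-- A derived barcode: the disjoint union over the cohomological degrees of ordinary barcodes. -/
abbrev DerivedBarcode (n : ℕ) : Type := ℤ → Barcode n

/-- The derived barcode of an object of `D^b(rep_k A_n)`: the disjoint union of the barcodes of
its cohomologies. -/
noncomputable def derivedBarcode {k : Type u} [Field k] {n : ℕ}
    [HasDerivedCategory.{w₁} (Rep k n)] (X : DerivedCategory.Bounded (Rep k n)) :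
    DerivedBarcode n :=
  fun i => barcode ((cohomology (Rep k n) i).obj X)

/-- Two derived barcodes are `δ`-matched if they are so in every degree. -/
def IsDerivedMatched {n : ℕ} (δ : ℕ) (B B' : DerivedBarcode n) : Prop :=
  ∀ i : ℤ, IsMatched δ (B i) (B' i)

/-- The derived bottleneck distance between derived barcodes. -/
noncomputable def derivedBottleneckDist {n : ℕ} (B B' : DerivedBarcode n) : ℝ≥0∞ :=
  ⨅ (δ : ℕ) (_ : IsDerivedMatched δ B B'), (δ : ℝ≥0∞)

/-! ### The distances induced by a functor `E : D^b(A) ⥤ D^b(rep_k A_n)` -/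

section Induced

variable {A : Type u₁} [Category.{v₁} A] [Abelian A] [HasDerivedCategory.{w₁} A]
  {k : Type u} [Field k] {n : ℕ} [HasDerivedCategory.{w₂} (Rep k n)]
  (E : DerivedCategory.Bounded A ⥤ DerivedCategory.Bounded (Rep k n))

/-- `X` and `Y` are `δ`-interleaved with respect to `E`. -/
def IsInterleavedWrt (δ : ℕ) (X Y : DerivedCategory.Bounded A) : Prop :=
  IsDerivedInterleaved δ (E.obj X) (E.obj Y)

/-- The interleaving distance `d_I^{E,A}(X, Y)` with respect to `E`. -/
noncomputable def interleavingDistWrt (X Y : DerivedCategory.Bounded A) : ℝ≥0∞ :=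
  ⨅ (δ : ℕ) (_ : IsInterleavedWrt E δ X Y), (δ : ℝ≥0∞)

/-- The barcodes of `X` and `Y` are `δ`-matched with respect to `E`: by definition, the derived
barcodes of `E(X)` and `E(Y)` are `δ`-matched. -/
def IsMatchedWrt (δ : ℕ) (X Y : DerivedCategory.Bounded A) : Prop :=
  IsDerivedMatched δ (derivedBarcode (E.obj X)) (derivedBarcode (E.obj Y))

/-- The bottleneck distance `d_B^{E,A}` with respect to `E` between the barcodes of `X`
and `Y`. -/
noncomputable def bottleneckDistWrt (X Y : DerivedCategory.Bounded A) : ℝ≥0∞ :=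
  ⨅ (δ : ℕ) (_ : IsMatchedWrt E δ X Y), (δ : ℝ≥0∞)

end Induced

end DerivedPersistence

namespace DerivedPersistence

/-! ### Partial matchings -/

section Matching

variable {α β : Type*}

/-! Both distances are infima over `δ` of conditions on `E(X)` and `E(Y)`, so it is enough that for
each fixed `δ` the derived barcodes are `δ`-matched exactly when the objects are derived
`δ`-interleaved. Both conditions are tested on cohomology, degree by degree, and two facts remain.

The first is the isometry theorem for representations, `isMatched_iff_exists_isInterleavingPair`.
Given a matching, send the generator of each matched bar to that of its partner; an unmatched bar
has length less than `2δ`, so the transition map by `2δ` kills it. Conversely, interval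
decompositions (`isIntervalDecomposable`) turn an interleaving into two matrices `F` and `G`. A
nonzero entry forces inequalities between the endpoints of the two bars. If the long bars are
ordered by `b + d`, then `G F`, computed through nearby bars only, is unitriangular, so rank
considerations give Hall's condition (`exists_injective_near`). Exchanging the two sides gives a
second injection, and the Mendelsohn–Dulmage theorem `exists_pequiv_covering` merges both into one
matching.

The second is a lifting property. Taking cohomology of a derived interleaving is immediate; the
other direction needs morphisms in the derived category with prescribed effect on all cohomologies.
They exist because `rep_k A_n` is hereditary (`exists_projective_resolution`, `exists_derived_hom`).
The interleaving identities are only required on cohomology, so any lifts will do. -/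

/-- A relation which is a partial injective function, as a `PEquiv`. -/
lemma exists_pequiv_of_rel (P : α → β → Prop) (hr : ∀ a b b', P a b → P a b' → b = b')
    (hl : ∀ a a' b, P a b → P a' b → a = a') :
    ∃ σ : α ≃. β, ∀ a b, b ∈ σ a ↔ P a b := by
  classical
  have keyr : ∀ a b, b ∈ (if h : ∃ b, P a b then some h.choose else none) ↔ P a b := by
    intro a b
    split_ifs with h
    · simp only [Option.mem_def, Option.some.injEq]
      exact ⟨fun e => e ▸ h.choose_spec, fun hb => hr _ _ _ h.choose_spec hb⟩
    · simp only [Option.mem_def, reduceCtorEq, false_iff]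
      exact fun hb => h ⟨b, hb⟩
  have keyl : ∀ b a, a ∈ (if h : ∃ a, P a b then some h.choose else none) ↔ P a b := by
    intro b a
    split_ifs with h
    · simp only [Option.mem_def, Option.some.injEq]
      exact ⟨fun e => e ▸ h.choose_spec, fun hb => hl _ _ _ h.choose_spec hb⟩
    · simp only [Option.mem_def, reduceCtorEq, false_iff]
      exact fun hb => h ⟨a, hb⟩
  refine ⟨⟨fun a => if h : ∃ b, P a b then some h.choose else none,
    fun b => if h : ∃ a, P a b then some h.choose else none, fun a b => ?_⟩, fun a b => ?_⟩
  · exact (keyl b a).trans (keyr a b).symm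
  · exact keyr a b

/-- The elements reached by alternating paths which start outside the image of `g`. -/
inductive AltReachable {A : α → Prop} {B : β → Prop} (f : {a // A a} → β)
    (g : {b // B b} → α) : α → Prop
  | base (a : α) (h : ∀ b, g b ≠ a) : AltReachable f g a
  | step (a : {a // A a}) (b : {b // B b}) (h : AltReachable f g a.1) (hb : f a = b) :
      AltReachable f g (g b)

/-- The Mendelsohn–Dulmage theorem: if a relation contains an injection defined on `A` and the
transpose of an injection defined on `B`, then it contains a matching covering `A` and `B`. -/
theorem exists_pequiv_covering (r : α → β → Prop) {A : α → Prop} {B : β → Prop} (f : {a // A a} → β)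
    (g : {b // B b} → α)
    (hf : Function.Injective f) (hg : Function.Injective g) (hfr : ∀ a : {a // A a}, r a (f a))
    (hgr : ∀ b : {b // B b}, r (g b) b) :
    ∃ σ : α ≃. β, (∀ a, A a → ∃ b, b ∈ σ a) ∧ (∀ b, B b → ∃ a, b ∈ σ a) ∧
      ∀ a b, b ∈ σ a → r a b := by
  have step : ∀ (a : {a // A a}) (b : {b // B b}), AltReachable f g a.1 → f a = b →
      AltReachable f g (g b) :=
    fun a b h hb => .step a b h hb
  -- A base point is outside the image of `g`, so a reachable `g b` was entered through an edge `f a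
  -- = b`. This is what covers `b` when `g b` is matched by `f`.
  have inv : ∀ b : {b // B b}, AltReachable f g (g b) →
      ∃ a : {a // A a}, AltReachable f g a.1 ∧ f a = b := by
    intro b hb
    generalize hx : g b = x at hb
    cases hb with
    | base _ h => exact absurd hx (h b)
    | step a b' h hb' => exact ⟨a, h, by rw [hb', hg hx]⟩
  -- Match reachable elements by `f` and unreachable ones by the inverse of `g`; an unreachable
  -- element always lies in the image of `g`. The two rules never claim the same `b`, since `f a =
  -- b` with `a` reachable makes `g b` reachable.
  obtain ⟨σ, hσ⟩ := exists_pequiv_of_rel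
    (fun a b => (∃ h : A a, AltReachable f g a ∧ f ⟨a, h⟩ = b) ∨
      (¬ AltReachable f g a ∧ ∃ h : B b, g ⟨b, h⟩ = a)) (by
      rintro a b b' (⟨h, hD, rfl⟩ | ⟨hD, h, rfl⟩) (⟨h', hD', rfl⟩ | ⟨hD', h', hh⟩)
      · rfl
      · exact absurd hD hD'
      · exact absurd hD' hD
      · exact congrArg Subtype.val (hg hh).symm) (by
      rintro a a' b (⟨h, hD, rfl⟩ | ⟨hD, h, rfl⟩) (⟨h', hD', hh⟩ | ⟨hD', h', rfl⟩)
      · exact congrArg Subtype.val (hf hh).symm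
      · exact absurd (step ⟨a, h⟩ ⟨_, h'⟩ hD rfl) hD'
      · exact absurd (step ⟨a', h'⟩ ⟨_, h⟩ hD' hh) hD
      · rfl)
  refine ⟨σ, fun a ha => ?_, fun b hb => ?_, fun a b h => ?_⟩
  · by_cases hD : AltReachable f g a
    · exact ⟨_, (hσ _ _).2 (Or.inl ⟨ha, hD, rfl⟩)⟩
    · have : ∃ b, g b = a := by
        by_contra! h
        exact hD (.base a h)
      obtain ⟨b, hb⟩ := this
      exact ⟨b, (hσ _ _).2 (Or.inr ⟨hD, b.2, hb⟩)⟩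
  · by_cases hD : AltReachable f g (g ⟨b, hb⟩)
    · obtain ⟨a, ha, hab⟩ := inv _ hD
      exact ⟨a, (hσ _ _).2 (Or.inl ⟨a.2, ha, hab⟩)⟩
    · exact ⟨_, (hσ _ _).2 (Or.inr ⟨hD, hb, rfl⟩)⟩
  · rcases (hσ _ _).1 h with ⟨ha, -, rfl⟩ | ⟨-, hb, rfl⟩
    · exact hfr ⟨a, ha⟩
    · exact hgr ⟨b, hb⟩

end Matching

/-! ### Hall's condition from the matrices of an interleaving -/

section Coefficients

variable {k : Type*} [Field k] {S T : Type*}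

/-- If `G F` is unitriangular with respect to `w` on `A` and factors through `U`, then
`|A| ≤ |U|`. -/
lemma card_le_card_of_unitriangular [DecidableEq S] (F : T → S → k) (G : S → T → k) (w : S → ℕ)
    (A : Finset S) (U : Finset T)
    (h : ∀ s ∈ A, ∀ s' ∈ A, w s ≤ w s' →
      ∑ t ∈ U, G s' t * F t s = if s = s' then 1 else 0) :
    A.card ≤ U.card := by
  classical
  by_contra! hlt
  let Φ : (A → k) →ₗ[k] (U → k) :=
    Matrix.mulVecLin (Matrix.of fun (t : U) (s : A) => F t s)
  have hker : LinearMap.ker Φ ≠ ⊥ := LinearMap.ker_ne_bot_of_finrank_lt (by simpa using hlt)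
  obtain ⟨v, hv, hv0⟩ := Submodule.exists_mem_ne_zero_of_ne_bot hker
  have hne : (Finset.univ.filter fun s : A => v s ≠ 0).Nonempty := by
    by_contra! hempty
    refine hv0 (funext fun s => ?_)
    by_contra hs
    have : s ∈ Finset.univ.filter fun s : A => v s ≠ 0 := by simpa using hs
    simp [hempty] at this
  -- A kernel vector `v` of `F` is tested at an index `s'` of maximal weight in its support: there
  -- only the unitriangular entries of `G F` contribute, so the `s'` coordinate of `G F v = 0` is `v
  -- s'`.
  obtain ⟨s', hs', hmax⟩ := Finset.exists_max_image _ (fun s : A => w s) hne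
  have hs'0 : v s' ≠ 0 := by simpa using hs'
  have hsum : ∀ t : U, ∑ s : A, F t s * v s = 0 := fun t => by
    simpa [Φ, Matrix.mulVec, dotProduct] using congrFun hv t
  refine hs'0 ?_
  calc v s' = ∑ s : A, (if (s : S) = s' then 1 else 0) * v s := by simp
    _ = ∑ s : A, (∑ t ∈ U, G s' t * F t s) * v s := by
        refine Finset.sum_congr rfl fun s _ => ?_
        by_cases hs : v s = 0
        · simp [hs]
        · rw [h s s.2 s' s'.2 (hmax s (by simpa using hs))]
    _ = ∑ t ∈ U, G s' t * ∑ s : A, F t s * v s := by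
        simp_rw [Finset.sum_mul, Finset.mul_sum]
        rw [Finset.sum_comm]
        simp_rw [mul_assoc]
    _ = 0 := Finset.sum_eq_zero fun t ht => by rw [hsum ⟨t, ht⟩, mul_zero]

/-- The closeness condition for two intervals. -/
def Near (δ b d b' d' : ℕ) : Prop :=
  (b' ≤ b + δ ∧ d ≤ d' + δ) ∧ (b ≤ b' + δ ∧ d' ≤ d + δ)

/-- Bars longer than `2δ` can be matched, given the coefficients of a `δ`-interleaving. -/
lemma exists_injective_near [Fintype T] [DecidableEq S] (δ : ℕ) (b d : S → ℕ) (b' d' : T → ℕ)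
    (F : T → S → k) (G : S → T → k)
    (hF : ∀ t s, F t s ≠ 0 → b' t ≤ b s + δ ∧ b s + δ ≤ d' t ∧ d' t ≤ d s + δ)
    (hG : ∀ s t, G s t ≠ 0 → b s ≤ b' t + δ ∧ b' t + δ ≤ d s ∧ d s ≤ d' t + δ)
    (hGF : ∀ s s', b s' ≤ b s + 2 * δ → b s + 2 * δ ≤ d s' →
      ∑ t, G s' t * F t s = if s = s' then 1 else 0) :
    ∃ f : {s // b s + 2 * δ ≤ d s} → T, Function.Injective f ∧
      ∀ s : {s // b s + 2 * δ ≤ d s}, Near δ (b s) (d s) (b' (f s)) (d' (f s)) := by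
  classical
  let N : {s // b s + 2 * δ ≤ d s} → Finset T := fun s =>
    Finset.univ.filter fun t => Near δ (b s) (d s) (b' t) (d' t)
  -- Hall's theorem for the nearby bars `N s`, with the weight `b + d` for the triangularity.
  obtain ⟨f, hf, hfN⟩ := (Finset.all_card_le_biUnion_card_iff_exists_injective N).1 (by
    intro A
    rw [← Finset.card_map (Function.Embedding.subtype _)]
    refine card_le_card_of_unitriangular F G (fun s => b s + d s) _ _ ?_
    intro s hs s' hs' hw
    obtain ⟨⟨s, hsl⟩, hsA, rfl⟩ := Finset.mem_map.1 hs
    obtain ⟨⟨s', hsl'⟩, hsA', rfl⟩ := Finset.mem_map.1 hs'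
    rw [Function.Embedding.subtype_apply] at *
    change b s + d s ≤ b s' + d s' at hw
    -- Terms outside the neighbourhoods vanish: if `t` supports a nonzero product but is near
    -- neither `s` nor `s'`, the endpoint inequalities give `b s' + d s' < b s + d s`, against `hw`.
    have hsub : ∑ t ∈ A.biUnion N, G s' t * F t s = ∑ t, G s' t * F t s := by
      refine Finset.sum_subset (Finset.subset_univ _) fun t _ ht => ?_
      by_contra hne
      have h1 := hF t s (right_ne_zero_of_mul hne)
      have h2 := hG s' t (left_ne_zero_of_mul hne)
      have n1 : ¬ Near δ (b s) (d s) (b' t) (d' t) := fun hn =>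
        ht (Finset.mem_biUnion.2 ⟨_, hsA, by simpa [N] using hn⟩)
      have n2 : ¬ Near δ (b s') (d s') (b' t) (d' t) := fun hn =>
        ht (Finset.mem_biUnion.2 ⟨_, hsA', by simpa [N] using hn⟩)
      unfold Near at n1 n2
      omega
    change ∑ t ∈ A.biUnion N, G s' t * F t s = if s = s' then 1 else 0
    rw [hsub]
    -- If `s'` is born by `b s + 2δ`, the weight inequality and the length of both bars show that it
    -- is still alive there, so `hGF` applies. Otherwise `s ≠ s'`, and the birth inequalities rule
    -- out every product.
    by_cases h1 : b s' ≤ b s + 2 * δ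
    · exact hGF s s' h1 (by omega)
    · rw [if_neg (by rintro rfl; omega)]
      refine Finset.sum_eq_zero fun t _ => ?_
      by_contra hne
      have h1 := hF t s (right_ne_zero_of_mul hne)
      have h2 := hG s' t (left_ne_zero_of_mul hne)
      omega)
  exact ⟨f, hf, fun s => by simpa [N] using hfN s⟩

end Coefficients

end DerivedPersistence

namespace DerivedPersistence

universe u

/-! ### Interval representations -/

section IntervalRep

variable {k : Type u} [Field k] {n : ℕ}

variable (k) in
/-- The one-dimensional vector space. -/
abbrev line : FGModuleCat.{u} k := FGModuleCat.of k k

/-- The vertices of an interval. -/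
abbrev Interval.Mem (I : Interval n) (x : Fin n) : Prop := I.1.1 ≤ x ∧ x ≤ I.1.2

lemma intervalRep_obj (I : Interval n) {x : Fin n} (h : I.Mem x) :
    (intervalRep k I).obj x = line k := if_pos h

lemma isZero_intervalRep_obj (I : Interval n) {x : Fin n} (h : ¬ I.Mem x) :
    IsZero ((intervalRep k I).obj x) := by
  change IsZero (ite _ _ _)
  rw [if_neg h]
  exact isZero_zero _

/-- The generator of an interval representation at a vertex. -/
noncomputable def intervalGen (I : Interval n) (x : Fin n) : line k ⟶ (intervalRep k I).obj x :=
  if h : I.Mem x then eqToHom (intervalRep_obj I h).symm else 0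

/-- The coordinate of an interval representation at a vertex. -/
noncomputable def intervalCoord (I : Interval n) (x : Fin n) :
    (intervalRep k I).obj x ⟶ line k :=
  if h : I.Mem x then eqToHom (intervalRep_obj I h) else 0

lemma intervalGen_of_not_mem (I : Interval n) {x : Fin n} (h : ¬ I.Mem x) :
    intervalGen (k := k) I x = 0 := dif_neg h

lemma intervalGen_coord (I : Interval n) {x : Fin n} (h : I.Mem x) :
    intervalGen (k := k) I x ≫ intervalCoord I x = 𝟙 _ := by
  rw [intervalGen, intervalCoord, dif_pos h, dif_pos h, eqToHom_trans, eqToHom_refl]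

lemma intervalCoord_gen (I : Interval n) (x : Fin n) :
    intervalCoord (k := k) I x ≫ intervalGen I x = 𝟙 _ := by
  by_cases h : I.Mem x
  · rw [intervalGen, intervalCoord, dif_pos h, dif_pos h, eqToHom_trans, eqToHom_refl]
  · exact (isZero_intervalRep_obj I h).eq_of_src _ _

lemma intervalRep_map (I : Interval n) {x y : Fin n} (e : x ⟶ y) (hx : I.Mem x) (hy : I.Mem y) :
    (intervalRep k I).map e =
      eqToHom ((intervalRep_obj I hx).trans (intervalRep_obj I hy).symm) :=
  dif_pos ⟨hx, hy⟩

lemma intervalGen_map (I : Interval n) {x y : Fin n} (e : x ⟶ y) (hx : I.1.1 ≤ x) :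
    intervalGen (k := k) I x ≫ (intervalRep k I).map e = intervalGen I y := by
  have hxy := leOfHom e
  by_cases hy : I.Mem y
  · have hx' : I.Mem x := ⟨hx, hxy.trans hy.2⟩
    rw [intervalRep_map I e hx' hy, intervalGen, intervalGen, dif_pos hx', dif_pos hy,
      eqToHom_trans]
  · exact (isZero_intervalRep_obj I hy).eq_of_tgt _ _

lemma intervalMap_coord (I : Interval n) {x y : Fin n} (e : x ⟶ y) (hy : y ≤ I.1.2) :
    (intervalRep k I).map e ≫ intervalCoord I y = intervalCoord I x := by
  have hxy := leOfHom e
  by_cases hx : I.Mem x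
  · have hy' : I.Mem y := ⟨hx.1.trans hxy, hy⟩
    rw [intervalRep_map I e hx hy', intervalCoord, intervalCoord, dif_pos hx, dif_pos hy',
      eqToHom_trans]
  · exact (isZero_intervalRep_obj I hx).eq_of_src _ _

/-- The morphism from an interval representation given by an element of `M_b` which dies
after `d`. -/
noncomputable def intervalDesc (I : Interval n) {M : Rep k n} (v : line k ⟶ M.obj I.1.1)
    (hv : ∀ (y : Fin n) (h : I.1.1 ≤ y), ¬ y ≤ I.1.2 → v ≫ M.map (homOfLE h) = 0) :
    intervalRep k I ⟶ M where
  app x := if h : I.1.1 ≤ x then intervalCoord I x ≫ v ≫ M.map (homOfLE h) else 0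
  naturality x y e := by
    by_cases hx : I.1.1 ≤ x
    · have hy : I.1.1 ≤ y := hx.trans (leOfHom e)
      simp only [hx, hy, dif_pos, Category.assoc, ← Functor.map_comp]
      change _ = intervalCoord I x ≫ v ≫ M.map (homOfLE hy)
      by_cases hyd : y ≤ I.1.2
      · rw [reassoc_of% intervalMap_coord (k := k) I e hyd]
      · rw [hv y hy hyd, comp_zero, comp_zero, comp_zero]
    · exact (isZero_intervalRep_obj I fun h => hx h.1).eq_of_src _ _

/-- The morphism to an interval representation given by a functional on `M_d` which vanishes on
the image of `M_x` for `x < b`. -/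
noncomputable def intervalLift (I : Interval n) {M : Rep k n} (l : M.obj I.1.2 ⟶ line k)
    (hl : ∀ (x : Fin n) (h : x ≤ I.1.2), ¬ I.1.1 ≤ x → M.map (homOfLE h) ≫ l = 0) :
    M ⟶ intervalRep k I where
  app x := if h : x ≤ I.1.2 then M.map (homOfLE h) ≫ l ≫ intervalGen I x else 0
  naturality x y e := by
    by_cases hy : y ≤ I.1.2
    · have hx : x ≤ I.1.2 := (leOfHom e).trans hy
      simp only [hx, hy, dif_pos, Category.assoc, ← Functor.map_comp_assoc]
      change M.map (homOfLE hx) ≫ _ = _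
      by_cases hxb : I.1.1 ≤ x
      · rw [intervalGen_map I e hxb]
      · rw [reassoc_of% hl x hx hxb, reassoc_of% hl x hx hxb, zero_comp, zero_comp]
    · exact (isZero_intervalRep_obj I fun h => hy h.2).eq_of_tgt _ _

lemma intervalDesc_lift (I : Interval n) {M : Rep k n} (v : line k ⟶ M.obj I.1.1) (hv)
    (l : M.obj I.1.2 ⟶ line k) (hl) (h : v ≫ M.map (homOfLE I.2) ≫ l = 𝟙 _) :
    intervalDesc I v hv ≫ intervalLift I l hl = 𝟙 _ := by
  ext x : 2
  by_cases hx : I.Mem x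
  · simp only [intervalDesc, intervalLift, NatTrans.comp_app, hx.1, hx.2, dif_pos,
      Category.assoc, ← Functor.map_comp_assoc]
    rw [show homOfLE hx.1 ≫ homOfLE hx.2 = homOfLE I.2 from rfl, reassoc_of% h,
      intervalCoord_gen]
    rfl
  · exact (isZero_intervalRep_obj I hx).eq_of_src _ _

end IntervalRep

/-! ### Interval decompositions -/

section Decomposition

variable {k : Type u} [Field k] {n : ℕ}

/-- `M` is a direct sum of interval representations. -/
def IsIntervalDecomposable (M : Rep k n) : Prop :=
  ∃ (T : Type) (_ : Fintype T) (J : T → Interval n) (i : ∀ t, intervalRep k (J t) ⟶ M)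
    (p : ∀ t, M ⟶ intervalRep k (J t)),
    (∀ t, i t ≫ p t = 𝟙 _) ∧ (∀ s t, s ≠ t → i s ≫ p t = 0) ∧ ∑ t, p t ≫ i t = 𝟙 M

lemma IsIntervalDecomposable.exists_isBarcode {M : Rep k n} (hM : IsIntervalDecomposable M) :
    ∃ B : Barcode n, IsBarcode M B := by
  classical
  obtain ⟨T, _, J, i, p, h1, h2, h3⟩ := hM
  let B : Barcode n := fun I => Fintype.card {t // J t = I}
  let e : B.Bar ≃ T := (Equiv.sigmaCongrRight fun I => (Fintype.equivFin {t // J t = I}).symm).trans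
    (Equiv.sigmaFiberEquiv J)
  have he : ∀ s : B.Bar, J (e s) = s.1 := fun s => ((Fintype.equivFin {t // J t = s.1}).symm s.2).2
  have e1 : M ≅ ⨁ fun t => intervalRep k (J t) :=
    { hom := biproduct.lift p
      inv := biproduct.desc i
      hom_inv_id := by rw [biproduct.lift_desc, h3]
      inv_hom_id := by
        refine biproduct.hom_ext' _ _ fun s => biproduct.hom_ext _ _ fun t => ?_
        by_cases hst : s = t
        · subst hst
          simp [h1]
        · simp [h2 _ _ hst, biproduct.ι_π_ne _ hst] }
  exact ⟨B, ⟨e1 ≪≫ (biproduct.whiskerEquiv e fun s => eqToIso (by rw [he s])).symm⟩⟩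

/-- Adding an interval summand. -/
lemma IsIntervalDecomposable.of_split {M K : Rep k n} (hK : IsIntervalDecomposable K)
    (I : Interval n) (i : intervalRep k I ⟶ M) (r : M ⟶ intervalRep k I) (a : K ⟶ M) (p : M ⟶ K)
    (hir : i ≫ r = 𝟙 _) (hap : a ≫ p = 𝟙 _) (hip : i ≫ p = 0) (har : a ≫ r = 0)
    (htot : r ≫ i + p ≫ a = 𝟙 M) : IsIntervalDecomposable M := by
  obtain ⟨T, _, J, i', p', h1, h2, h3⟩ := hK
  refine ⟨Option T, inferInstance, fun t => t.elim I J,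
    fun t => match t with
      | none => i
      | some t => i' t ≫ a,
    fun t => match t with
      | none => r
      | some t => p ≫ p' t, ?_, ?_, ?_⟩
  · rintro (_ | t)
    · exact hir
    · simpa [reassoc_of% hap] using h1 t
  · rintro (_ | s) (_ | t) hst
    · exact absurd rfl hst
    · change i ≫ p ≫ p' t = 0
      rw [reassoc_of% hip, zero_comp]
    · change (i' s ≫ a) ≫ r = 0
      rw [Category.assoc, har, comp_zero]
    · change (i' s ≫ a) ≫ p ≫ p' t = 0
      rw [Category.assoc, reassoc_of% hap]
      exact h2 s t (fun h => hst (h ▸ rfl))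
  · rw [Fintype.sum_option]
    change r ≫ i + ∑ t, (p ≫ p' t) ≫ i' t ≫ a = 𝟙 M
    have h4 : ∑ t, (p ≫ p' t) ≫ i' t ≫ a = p ≫ (∑ t, p' t ≫ i' t) ≫ a := by
      simp only [Preadditive.sum_comp, Preadditive.comp_sum, Category.assoc]
    rw [h4, h3, Category.id_comp, htot]

/-- The total dimension of a representation. -/
noncomputable def totalDim (M : Rep k n) : ℕ := ∑ x, Module.finrank k (M.obj x)

lemma exists_comp_ne_zero {V W : FGModuleCat.{u} k} (f : V ⟶ W) (hf : f ≠ 0) :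
    ∃ v : line k ⟶ V, v ≫ f ≠ 0 := by
  by_contra! h
  refine hf (FGModuleCat.hom_ext (LinearMap.ext fun x => ?_))
  have := h (FGModuleCat.ofHom (LinearMap.toSpanSingleton k V x))
  have h2 : f.hom.hom (LinearMap.toSpanSingleton k V x 1) = 0 :=
    LinearMap.congr_fun (congrArg (fun g => g.hom.hom) this) (1 : k)
  simpa using h2

lemma exists_retraction {W : FGModuleCat.{u} k} (v : line k ⟶ W) (hv : v ≠ 0) :
    ∃ l : W ⟶ line k, v ≫ l = 𝟙 _ := by
  have hv1 : LinearMap.ker v.hom.hom = ⊥ := by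
    refine LinearMap.ker_eq_bot'.2 fun (a : k) ha => ?_
    by_contra ha0
    refine hv (FGModuleCat.hom_ext (LinearMap.ext_ring ?_))
    have h1 : v.hom.hom ((a⁻¹ * a : k)) = 0 := by
      rw [← smul_eq_mul, map_smul, ha, smul_zero]
    rwa [inv_mul_cancel₀ ha0] at h1
  obtain ⟨g, hg⟩ := LinearMap.exists_leftInverse_of_injective _ hv1
  exact ⟨FGModuleCat.ofHom g, FGModuleCat.hom_ext hg⟩

lemma app_injective_of_mono {M N : Rep k n} (f : M ⟶ N) [Mono f] (x : Fin n) :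
    Function.Injective (f.app x).hom.hom := by
  have : Mono ((forget₂ (FGModuleCat k) (ModuleCat k)).map (f.app x)) := inferInstance
  exact (ModuleCat.mono_iff_injective _).1 this

/-- Every representation of `A_n` is a direct sum of interval representations. -/
theorem isIntervalDecomposable (M : Rep k n) : IsIntervalDecomposable M := by
  classical
  induction hN : totalDim M using Nat.strong_induction_on generalizing M with
  | _ N ih =>
  subst hN
  by_cases hM : ∀ x, IsZero (M.obj x)
  · exact ⟨Empty, inferInstance, fun t => t.elim, fun t => t.elim, fun t => t.elim,
      fun t => t.elim, fun t => t.elim, by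
        ext x : 2
        exact (hM x).eq_of_src _ _⟩
  push Not at hM
  obtain ⟨x, hx⟩ := hM
  have hne : (Finset.univ.filter fun I : Interval n => M.map (homOfLE I.2) ≠ 0).Nonempty := by
    refine ⟨⟨(x, x), le_refl x⟩, Finset.mem_filter.2 ⟨Finset.mem_univ _, fun h => hx ?_⟩⟩
    rw [IsZero.iff_id_eq_zero, ← M.map_id]
    exact h
  -- Choose a nonzero structure map `M_b → M_d` with `d - b` maximal. By maximality every element of
  -- `M_b` dies after `d`, and every functional on `M_d` vanishes on what comes from before `b`. So
  -- a vector with nonzero image and a functional detecting it split off `𝕀[b,d]`.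
  obtain ⟨I, hI, hmax⟩ := Finset.exists_max_image _
    (fun I : Interval n => (I.1.2 : ℕ) - (I.1.1 : ℕ)) hne
  have hlong : ∀ (y z : Fin n) (h : y ≤ z), (I.1.2 : ℕ) - (I.1.1 : ℕ) < (z : ℕ) - (y : ℕ) →
      M.map (homOfLE h) = 0 := by
    intro y z h hlt
    by_contra h0
    exact absurd (hmax ⟨(y, z), h⟩ (Finset.mem_filter.2 ⟨Finset.mem_univ _, h0⟩)) (not_le.2 hlt)
  obtain ⟨v, hv⟩ := exists_comp_ne_zero _ (Finset.mem_filter.1 hI).2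
  obtain ⟨l, hl⟩ := exists_retraction _ hv
  have hbd : (I.1.1 : ℕ) ≤ (I.1.2 : ℕ) := I.2
  let i := intervalDesc I v fun y h hy => by
    rw [hlong _ _ h (by have : ¬ (y : ℕ) ≤ (I.1.2 : ℕ) := hy; omega), comp_zero]
  let r := intervalLift I l fun y h hy => by
    rw [hlong _ _ h (by have : ¬ (I.1.1 : ℕ) ≤ (y : ℕ) := hy; omega), zero_comp]
  have hir : i ≫ r = 𝟙 _ := intervalDesc_lift I v _ l _ (by rw [← Category.assoc]; exact hl)
  let p : M ⟶ kernel r := kernel.lift r (𝟙 M - r ≫ i) (by simp [hir])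
  have hpa : p ≫ kernel.ι r = 𝟙 M - r ≫ i := kernel.lift_ι _ _ _
  refine IsIntervalDecomposable.of_split (ih _ ?_ (kernel r) rfl) I i r (kernel.ι r) p hir ?_ ?_
    (kernel.condition r) (by rw [hpa]; abel)
  -- The complement `kernel r` is strictly smaller at the birth vertex: otherwise `r` would vanish
  -- there, although `i ≫ r` is the identity of a line.
  · refine Finset.sum_lt_sum (fun y _ => ?_) ⟨I.1.1, Finset.mem_univ _, ?_⟩
    · exact LinearMap.finrank_le_finrank_of_injective (app_injective_of_mono (kernel.ι r) y)
    · rw [← LinearMap.finrank_range_of_inj (app_injective_of_mono (kernel.ι r) I.1.1)]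
      refine Submodule.finrank_lt fun htop => ?_
      have hr : r.app I.1.1 = 0 := by
        refine FGModuleCat.hom_ext (LinearMap.ext fun w => ?_)
        obtain ⟨w', rfl⟩ := LinearMap.range_eq_top.1 htop w
        exact LinearMap.congr_fun (congrArg (fun g => (g.app I.1.1).hom.hom)
          (kernel.condition r)) w'
      have h1 : i.app I.1.1 ≫ r.app I.1.1 = 𝟙 _ := congrArg (fun g => g.app I.1.1) hir
      rw [hr, comp_zero] at h1
      have h2 := intervalGen_coord (k := k) I (x := I.1.1) ⟨le_refl _, I.2⟩
      rw [← Category.comp_id (intervalGen I I.1.1)] at h2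
      have h3 : (𝟙 (line k) : line k ⟶ line k) = 0 := by
        rw [← h2]
        refine Eq.trans (congrArg (fun g => (intervalGen I I.1.1 ≫ g) ≫ intervalCoord I I.1.1)
          h1.symm) ?_
        simp
      exact one_ne_zero (LinearMap.congr_fun (congrArg (fun g => g.hom.hom) h3) (1 : k))
  · rw [← cancel_mono (kernel.ι r), Category.assoc, hpa]
    simp
  · rw [← cancel_mono (kernel.ι r), Category.assoc, hpa]
    simp [reassoc_of% hir]

lemma isBarcode_barcode (M : Rep k n) : IsBarcode M (barcode M) := by
  have h := (isIntervalDecomposable M).exists_isBarcode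
  rw [barcode, dif_pos h]
  exact h.choose_spec

end Decomposition

end DerivedPersistence

namespace DerivedPersistence

universe u

/-! ### Morphisms to shifts as families of maps between extensions by zero -/

section ExtendShift

variable {C : Type*} [Category* C] [Abelian C] {n δ : ℕ}

/-- The components of a morphism `M ⟶ N(δ)`. -/
noncomputable def shiftApp {M N : Fin n ⥤ C} (f : M ⟶ (shift n δ).obj N) (x : Fin n) :
    M.obj x ⟶ extendObj N (x + δ) :=
  f.app x

lemma shiftApp_naturality {M N : Fin n ⥤ C} (f : M ⟶ (shift n δ).obj N) {x y : Fin n}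
    (e : x ⟶ y) :
    M.map e ≫ shiftApp f y =
      shiftApp f x ≫ extendMap N (Nat.add_le_add_right (show (x : ℕ) ≤ y from leOfHom e) δ) :=
  f.naturality e

lemma map_comp_extendObjIso_inv (M : Fin n ⥤ C) {x y : Fin n} (e : x ⟶ y) :
    M.map e ≫ (extendObjIso M y y.2).inv =
      (extendObjIso M x x.2).inv ≫ extendMap M (show (x : ℕ) ≤ y from leOfHom e) := by
  simp only [extendMap, y.2, dif_pos, Iso.inv_hom_id_assoc]
  rfl

/-- The components of a morphism `M ⟶ N(δ)`, extended by zero. -/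
noncomputable def extendShiftHom {M N : Fin n ⥤ C} (f : M ⟶ (shift n δ).obj N) (x : ℕ) :
    extendObj M x ⟶ extendObj N (x + δ) :=
  if h : x < n then (extendObjIso M x h).hom ≫ shiftApp f ⟨x, h⟩ else 0

lemma extendShiftHom_naturality {M N : Fin n ⥤ C} (f : M ⟶ (shift n δ).obj N) {x y : ℕ}
    (h : x ≤ y) :
    extendMap M h ≫ extendShiftHom f y =
      extendShiftHom f x ≫ extendMap N (Nat.add_le_add_right h δ) := by
  by_cases hy : y < n
  · have hx := h.trans_lt hy
    have h1 := shiftApp_naturality f (homOfLE (show (⟨x, hx⟩ : Fin n) ≤ ⟨y, hy⟩ from h))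
    rw [extendShiftHom, extendShiftHom, dif_pos hx, dif_pos hy, extendMap, dif_pos hy,
      Category.assoc, Category.assoc, Iso.inv_hom_id_assoc, h1, Category.assoc]
  · exact (isZero_extendObj N _ (by omega)).eq_of_tgt _ _

/-- A morphism `M ⟶ N(δ)` from a compatible family of maps. -/
noncomputable def shiftHomMk {M N : Fin n ⥤ C} (a : ∀ x, extendObj M x ⟶ extendObj N (x + δ))
    (ha : ∀ {x y : ℕ} (h : x ≤ y),
      extendMap M h ≫ a y = a x ≫ extendMap N (Nat.add_le_add_right h δ)) :
    M ⟶ (shift n δ).obj N where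
  app x := (extendObjIso M x x.2).inv ≫ a x
  naturality x y e := by
    change M.map e ≫ (extendObjIso M y y.2).inv ≫ a y =
      ((extendObjIso M x x.2).inv ≫ a x) ≫
        extendMap N (Nat.add_le_add_right (show (x : ℕ) ≤ y from leOfHom e) δ)
    rw [← Category.assoc, map_comp_extendObjIso_inv, Category.assoc, ha, Category.assoc]

lemma extendShiftHom_mk {M N : Fin n ⥤ C} (a : ∀ x, extendObj M x ⟶ extendObj N (x + δ)) (ha)
    (x : ℕ) : extendShiftHom (shiftHomMk a ha) x = a x := by
  by_cases h : x < n
  · rw [extendShiftHom, dif_pos h]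
    exact Iso.hom_inv_id_assoc _ _
  · exact (isZero_extendObj M x h).eq_of_src _ _

lemma extendMap_eqToHom (M : Fin n ⥤ C) {x y z : ℕ} (h : x ≤ y) (e : y = z) :
    extendMap M h ≫ eqToHom (congrArg (extendObj M) e) = extendMap M (h.trans e.le) := by
  subst e
  simp

lemma comp_comp_inv_comp_hom {D : Type*} [Category* D] {W X Y Z : D} (a : W ⟶ X)
    (b : X ⟶ Y) (e : Z ≅ Y) :
    (a ≫ b ≫ e.inv) ≫ e.hom = a ≫ b := by
  simp

lemma comp_eq_of_factorizations {D : Type*} [Category* D] {U V W X Y Z : D}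
    {p : U ⟶ W} {i : U ⟶ V} {a : V ⟶ W}
    {g : W ⟶ Z} {e : Z ⟶ X} {b : W ⟶ X} {q : X ⟶ Y} {s : Z ⟶ Y} (hp : p = i ≫ a)
    (hg : g ≫ e = b) (hs : s = e ≫ q) : p ≫ g ≫ s = i ≫ a ≫ b ≫ q := by
  subst hp hg hs
  simp

/-- This removes `shiftShiftIso` and its casts: on extensions by zero indexed by all of `ℕ`, the
composite literally runs from `x` through `x + δ` to `x + δ + δ`, and beyond the last vertex there
is nothing to check. -/
lemma comp_shiftMap_eq_transition_iff {M N : Fin n ⥤ C} (f : M ⟶ (shift n δ).obj N)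
    (g : N ⟶ (shift n δ).obj M) :
    f ≫ (shift n δ).map g ≫ (shiftShiftIso δ M).hom = transition (2 * δ) M ↔
      ∀ x : ℕ, extendShiftHom f x ≫ extendShiftHom g (x + δ) =
        extendMap M (show x ≤ x + δ + δ by omega) := by
  have key : ∀ x : Fin n, (f ≫ (shift n δ).map g ≫ (shiftShiftIso δ M).hom).app x =
      (extendObjIso M x x.2).inv ≫ extendShiftHom f x ≫ extendShiftHom g (x + δ) ≫
        eqToHom (congrArg (extendObj M) (show (x : ℕ) + δ + δ = x + 2 * δ by omega)) := by
    intro x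
    by_cases h : (x : ℕ) + δ < n
    · have h1 : (shiftShiftIso δ M).hom.app x = (extendObjIso (shiftObj δ M) _ h).hom ≫
          eqToHom (congrArg (extendObj M) (show (x : ℕ) + δ + δ = x + 2 * δ by omega)) := by
        simp only [shiftShiftIso, NatIso.ofComponents_hom_app, h, dif_pos, Iso.trans_hom,
          eqToIso.hom]
      have h2 : ((shift n δ).map g).app x ≫ (extendObjIso (shiftObj δ M) _ h).hom =
          extendShiftHom g (x + δ) := by
        change extendHom g _ ≫ _ = _
        rw [extendHom, dif_pos h, extendShiftHom, dif_pos h]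
        exact comp_comp_inv_comp_hom _ _ _
      have h3 : f.app x = (extendObjIso M x x.2).inv ≫ extendShiftHom f x := by
        rw [extendShiftHom, dif_pos x.2]
        exact (Iso.inv_hom_id_assoc _ _).symm
      exact comp_eq_of_factorizations h3 h2 h1
    · exact (isZero_extendObj M _ (by omega)).eq_of_tgt _ _
  constructor
  · intro h x
    by_cases hx : x < n
    · have h1 := key ⟨x, hx⟩
      rw [h] at h1
      change (extendObjIso M x hx).inv ≫ extendMap M (Nat.le_add_right x (2 * δ)) = _ at h1
      rw [cancel_epi, ← extendMap_eqToHom M (show x ≤ x + δ + δ by omega) (by omega),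
        ← Category.assoc (extendShiftHom f x), cancel_mono] at h1
      exact h1.symm
    · exact (isZero_extendObj M x hx).eq_of_src _ _
  · intro h
    ext x : 2
    rw [key x, reassoc_of% h x]
    change _ = (extendObjIso M x x.2).inv ≫ extendMap M (Nat.le_add_right (x : ℕ) (2 * δ))
    rw [extendMap_eqToHom M _ (by omega)]

lemma isInterleavingPair_iff {M N : Fin n ⥤ C} (f : M ⟶ (shift n δ).obj N)
    (g : N ⟶ (shift n δ).obj M) :
    IsInterleavingPair δ f g ↔
      (∀ x : ℕ, extendShiftHom f x ≫ extendShiftHom g (x + δ) =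
        extendMap M (show x ≤ x + δ + δ by omega)) ∧
      (∀ x : ℕ, extendShiftHom g x ≫ extendShiftHom f (x + δ) =
        extendMap N (show x ≤ x + δ + δ by omega)) :=
  and_congr (comp_shiftMap_eq_transition_iff f g) (comp_shiftMap_eq_transition_iff g f)

end ExtendShift

/-! ### Bases adapted to an interval decomposition -/

section Basis

variable {k : Type u} [Field k] {n : ℕ}

/-- Bases of the spaces of a representation (extended by zero) whose elements are born at `b`,
die after `d`, and are preserved by the structure maps in between. -/
structure PersistenceBasis (M : Rep k n) {S : Type} [Fintype S] (b d : S → ℕ) where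
  /-- The basis elements. -/
  gen (s : S) (x : ℕ) : line k ⟶ extendObj M x
  /-- The coordinates. -/
  coord (s : S) (x : ℕ) : extendObj M x ⟶ line k
  gen_coord (s : S) (x : ℕ) (hb : b s ≤ x) (hd : x ≤ d s) : gen s x ≫ coord s x = 𝟙 _
  gen_coord_ne (s t : S) (x : ℕ) (h : s ≠ t) : gen s x ≫ coord t x = 0
  total (x : ℕ) : ∑ s, coord s x ≫ gen s x = 𝟙 _
  gen_map (s : S) {x y : ℕ} (h : x ≤ y) (hb : b s ≤ x) : gen s x ≫ extendMap M h = gen s y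
  gen_eq_zero (s : S) (x : ℕ) (h : ¬ (b s ≤ x ∧ x ≤ d s)) : gen s x = 0

/-- The adapted basis which a barcode provides. -/
lemma IsBarcode.nonempty_persistenceBasis {M : Rep k n} {B : Barcode n} (h : IsBarcode M B) :
    Nonempty (PersistenceBasis M (fun s : B.Bar => (s.1.1.1 : ℕ)) fun s => (s.1.1.2 : ℕ)) := by
  classical
  obtain ⟨φ⟩ := h
  let i (s : B.Bar) : intervalRep k s.1 ⟶ M :=
    biproduct.ι (fun s : B.Bar => intervalRep k s.1) s ≫ φ.inv
  let p (s : B.Bar) : M ⟶ intervalRep k s.1 :=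
    φ.hom ≫ biproduct.π (fun s : B.Bar => intervalRep k s.1) s
  have h1 : ∀ s, i s ≫ p s = 𝟙 _ := fun s => by simp [i, p]
  have h2 : ∀ s t, s ≠ t → i s ≫ p t = 0 := fun s t hst => by
    simp [i, p, biproduct.ι_π_ne _ hst]
  have h3 : ∑ s, p s ≫ i s = 𝟙 M := by
    have : ∑ s, p s ≫ i s = φ.hom ≫ (∑ s, biproduct.π (fun s : B.Bar => intervalRep k s.1) s ≫
        biproduct.ι (fun s : B.Bar => intervalRep k s.1) s) ≫ φ.inv := by
      simp only [i, p, Preadditive.sum_comp, Preadditive.comp_sum, Category.assoc]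
    rw [this, biproduct.total, Category.id_comp, φ.hom_inv_id]
  have h1' : ∀ s x, (i s).app x ≫ (p s).app x = 𝟙 _ := fun s x =>
    congrArg (fun g => g.app x) (h1 s)
  have h2' : ∀ s t x, s ≠ t → (i s).app x ≫ (p t).app x = 0 := fun s t x hst =>
    congrArg (fun g => g.app x) (h2 s t hst)
  exact ⟨{
    gen s x := if h : x < n then
      intervalGen s.1 ⟨x, h⟩ ≫ (i s).app _ ≫ (extendObjIso M x h).inv else 0
    coord s x := if h : x < n then
      (extendObjIso M x h).hom ≫ (p s).app _ ≫ intervalCoord s.1 ⟨x, h⟩ else 0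
    gen_coord s x hb hd := by
      have hx : x < n := hd.trans_lt s.1.1.2.2
      simp only [hx, dif_pos, Category.assoc, Iso.inv_hom_id_assoc, reassoc_of% h1' s ⟨x, hx⟩]
      exact intervalGen_coord s.1 ⟨hb, hd⟩
    gen_coord_ne s t x hst := by
      by_cases hx : x < n
      · simp only [hx, dif_pos, Category.assoc, Iso.inv_hom_id_assoc,
          reassoc_of% h2' s t ⟨x, hx⟩ hst, zero_comp, comp_zero]
      · simp only [hx, dif_neg, not_false_eq_true, comp_zero]
    total x := by
      by_cases hx : x < n
      · have h3' : ∑ s, (p s).app ⟨x, hx⟩ ≫ (i s).app ⟨x, hx⟩ = 𝟙 _ := by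
          have := congrArg (fun g => g.app ⟨x, hx⟩) h3
          simpa [NatTrans.app_sum] using this
        simp only [hx, dif_pos, Category.assoc,
          reassoc_of% fun I : Interval n => intervalCoord_gen (k := k) I ⟨x, hx⟩]
        have : ∑ s, (extendObjIso M x hx).hom ≫ (p s).app ⟨x, hx⟩ ≫ (i s).app ⟨x, hx⟩ ≫
            (extendObjIso M x hx).inv = (extendObjIso M x hx).hom ≫
              (∑ s, (p s).app ⟨x, hx⟩ ≫ (i s).app ⟨x, hx⟩) ≫ (extendObjIso M x hx).inv := by
          simp only [Preadditive.sum_comp, Preadditive.comp_sum, Category.assoc]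
        rw [this, h3', Category.id_comp, Iso.hom_inv_id]
      · exact (isZero_extendObj M x hx).eq_of_src _ _
    gen_map s x y hxy hb := by
      by_cases hy : y < n
      · have hx := hxy.trans_lt hy
        simp only [hx, hy, dif_pos, extendMap, Category.assoc, Iso.inv_hom_id_assoc]
        rw [← NatTrans.naturality_assoc, reassoc_of% intervalGen_map (k := k) s.1 _ hb]
      · exact (isZero_extendObj M y hy).eq_of_tgt _ _
    gen_eq_zero s x h := by
      by_cases hx : x < n
      · rw [dif_pos hx, intervalGen_of_not_mem s.1 (x := ⟨x, hx⟩) h, zero_comp]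
      · rw [dif_neg hx] }⟩

end Basis

end DerivedPersistence

namespace DerivedPersistence

universe u

/-! ### The isometry theorem for representations -/

section Isometry

variable {k : Type u} [Field k] {n : ℕ}

/-- The scalar by which an endomorphism of the line acts. -/
def lineScalar (φ : line k ⟶ line k) : k := φ.hom.hom (1 : k)

lemma lineScalar_id : lineScalar (𝟙 (line k)) = 1 := rfl

lemma lineScalar_zero : lineScalar (0 : line k ⟶ line k) = 0 := rfl

lemma lineScalar_comp (φ ψ : line k ⟶ line k) :
    lineScalar (φ ≫ ψ) = lineScalar ψ * lineScalar φ := by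
  have h1 : ψ.hom.hom (φ.hom.hom (1 : k)) = ψ.hom.hom ((φ.hom.hom (1 : k) : k) • (1 : k)) := by
    rw [smul_eq_mul, mul_one]
  exact (h1.trans (map_smul _ _ _)).trans (mul_comm _ _)

lemma lineScalar_sum {T : Type*} (s : Finset T) (f : T → (line k ⟶ line k)) :
    lineScalar (∑ t ∈ s, f t) = ∑ t ∈ s, lineScalar (f t) := by
  classical
  induction s using Finset.induction_on with
  | empty => rfl
  | insert a s ha ih =>
    rw [Finset.sum_insert ha, Finset.sum_insert ha, ← ih]
    rfl

namespace PersistenceBasis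

variable {M N : Rep k n} {S T : Type} [Fintype S] [Fintype T] {b d : S → ℕ} {b' d' : T → ℕ}

lemma gen_comp_sum (P : PersistenceBasis M b d) {W : FGModuleCat.{u} k} (x : ℕ)
    (h : S → (line k ⟶ W)) (s : S) (hs : b s ≤ x ∧ x ≤ d s) :
    P.gen s x ≫ ∑ t, P.coord t x ≫ h t = h s := by
  rw [Preadditive.comp_sum, Finset.sum_eq_single s]
  · rw [← Category.assoc, P.gen_coord s x hs.1 hs.2, Category.id_comp]
  · intro t _ ht
    rw [← Category.assoc, P.gen_coord_ne s t x ht.symm, zero_comp]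
  · exact fun h => absurd (Finset.mem_univ _) h

lemma hom_ext (P : PersistenceBasis M b d) {W : FGModuleCat.{u} k} {x : ℕ}
    {f g : extendObj M x ⟶ W}
    (h : ∀ s, b s ≤ x ∧ x ≤ d s → P.gen s x ≫ f = P.gen s x ≫ g) : f = g := by
  rw [← Category.id_comp f, ← Category.id_comp g, ← P.total x, Preadditive.sum_comp,
    Preadditive.sum_comp]
  refine Finset.sum_congr rfl fun s _ => ?_
  rw [Category.assoc, Category.assoc]
  by_cases hs : b s ≤ x ∧ x ≤ d s
  · rw [h s hs]
  · rw [P.gen_eq_zero s x hs, zero_comp, zero_comp]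

/-- This need not be an axiom of `PersistenceBasis`: the generators span, and the only one that
`coord s` could detect is zero here. -/
lemma coord_eq_zero (P : PersistenceBasis M b d) (s : S) (x : ℕ) (h : ¬ (b s ≤ x ∧ x ≤ d s)) :
    P.coord s x = 0 := by
  refine P.hom_ext fun t _ => ?_
  by_cases hts : t = s
  · subst hts
    rw [P.gen_eq_zero t x h, zero_comp, zero_comp]
  · rw [P.gen_coord_ne t s x hts, comp_zero]

/-! ### From an interleaving to an injection of the long bars -/

section Coeff

variable (P : PersistenceBasis M b d) (Q : PersistenceBasis N b' d') {δ : ℕ}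
  (a : ∀ x, extendObj M x ⟶ extendObj N (x + δ))

/-- The matrix coefficients of a family of maps. -/
noncomputable def coeff (t : T) (s : S) : line k ⟶ line k :=
  P.gen s (b s) ≫ a (b s) ≫ Q.coord t (b s + δ)

lemma coeff_eq_zero (t : T) (s : S) (h : ¬ (b' t ≤ b s + δ ∧ b s + δ ≤ d' t)) :
    coeff P Q a t s = 0 := by
  rw [coeff, Q.coord_eq_zero t _ h, comp_zero, comp_zero]

variable (ha : ∀ {x y : ℕ} (h : x ≤ y),
  extendMap M h ≫ a y = a x ≫ extendMap N (Nat.add_le_add_right h δ))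

-- The coefficients are read off at the birth of `s`, and naturality transports the expansion to all
-- later vertices. Bars `t` not yet born at `b s + δ` have zero coefficient, so every generator
-- involved can be pushed forward.
include ha in
lemma gen_comp_eq_sum_coeff (s : S) (x : ℕ) (h : b s ≤ x) :
    P.gen s x ≫ a x = ∑ t, coeff P Q a t s ≫ Q.gen t (x + δ) := by
  rw [← P.gen_map s h le_rfl, Category.assoc, ha h, ← Category.id_comp (extendMap N _),
    ← Q.total, Preadditive.sum_comp, Preadditive.comp_sum, Preadditive.comp_sum]
  refine Finset.sum_congr rfl fun t _ => ?_
  by_cases ht : b' t ≤ b s + δ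
  · rw [Category.assoc, Q.gen_map t _ ht, coeff]
    simp only [Category.assoc]
  · rw [coeff_eq_zero P Q a t s (fun h => ht h.1), zero_comp, Q.coord_eq_zero t _ (fun h => ht h.1),
      zero_comp, zero_comp, comp_zero, comp_zero]

-- The first two inequalities say that `t` is alive at `b s + δ`, where the coefficient is read. For
-- the third, push forward to `d s + 1`, where `s` is dead: if `t` were still alive at `d s + 1 +
-- δ`, its coefficient would have to vanish.
include ha in
lemma coeff_support (hbd : ∀ s, b s ≤ d s) (t : T) (s : S) (h : coeff P Q a t s ≠ 0) :
    b' t ≤ b s + δ ∧ b s + δ ≤ d' t ∧ d' t ≤ d s + δ := by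
  have h1 : b' t ≤ b s + δ ∧ b s + δ ≤ d' t := by
    by_contra h1
    exact h (coeff_eq_zero P Q a t s h1)
  refine ⟨h1.1, h1.2, ?_⟩
  by_contra! h2
  refine h ?_
  have h3 := gen_comp_eq_sum_coeff P Q a ha s (d s + 1) ((hbd s).trans (Nat.le_succ _))
  have h5 := hbd s
  rw [P.gen_eq_zero s _ (by omega), zero_comp] at h3
  have h4 := congrArg (fun g => g ≫ Q.coord t (d s + 1 + δ)) h3.symm
  simp only [zero_comp, Preadditive.sum_comp, Category.assoc] at h4
  rw [Finset.sum_eq_single t (fun t' _ ht' => by rw [Q.gen_coord_ne t' t _ ht', comp_zero])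
    (fun h => absurd (Finset.mem_univ _) h), Q.gen_coord t _ (by omega) (by omega),
    Category.comp_id] at h4
  exact h4

variable (c : ∀ x, extendObj N x ⟶ extendObj M (x + δ)) (hc : ∀ {x y : ℕ} (h : x ≤ y),
  extendMap N h ≫ c y = c x ≫ extendMap M (Nat.add_le_add_right h δ))

-- Evaluate the transition map from `b s` to `b s + 2δ` on the generator of `s`, through `N`, and
-- take the coordinate at `s'`. The two inequalities say that `s'` is alive at that vertex;
-- elsewhere the coordinate carries no information.
include ha hc in
lemma sum_coeff_comp_coeff [DecidableEq S]
    (hac : ∀ x, a x ≫ c (x + δ) = extendMap M (show x ≤ x + δ + δ by omega)) (s s' : S)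
    (h1 : b s' ≤ b s + 2 * δ) (h2 : b s + 2 * δ ≤ d s') :
    ∑ t, coeff P Q a t s ≫ coeff Q P c s' t = if s = s' then 𝟙 _ else 0 := by
  have h3 : P.gen s (b s + δ + δ) ≫ P.coord s' (b s + δ + δ) =
      if s = s' then 𝟙 _ else 0 := by
    split_ifs with h
    · subst h
      exact P.gen_coord s _ (by omega) (by omega)
    · exact P.gen_coord_ne s s' _ h
  rw [← h3, ← P.gen_map s (show b s ≤ b s + δ + δ by omega) le_rfl, ← hac, ← Category.assoc,
    gen_comp_eq_sum_coeff P Q a ha s _ le_rfl, Preadditive.sum_comp, Preadditive.sum_comp]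
  refine Finset.sum_congr rfl fun t _ => ?_
  by_cases ht : b' t ≤ b s + δ
  · rw [Category.assoc, Category.assoc, ← Category.assoc (Q.gen t _),
      gen_comp_eq_sum_coeff Q P c hc t _ ht, Preadditive.sum_comp,
      Finset.sum_eq_single s' (fun t' _ ht' => by
        rw [Category.assoc, P.gen_coord_ne t' s' _ ht', comp_zero])
        (fun h => absurd (Finset.mem_univ _) h), Category.assoc,
        P.gen_coord s' _ (by omega) (by omega), Category.comp_id]
  · rw [coeff_eq_zero P Q a t s (fun h => ht h.1)]
    simp only [zero_comp]

include P Q ha hc in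
lemma exists_injective_near_of_interleaving (hbd : ∀ s, b s ≤ d s) (hbd' : ∀ t, b' t ≤ d' t)
    (hac : ∀ x, a x ≫ c (x + δ) = extendMap M (show x ≤ x + δ + δ by omega)) :
    ∃ f : {s // b s + 2 * δ ≤ d s} → T, Function.Injective f ∧
      ∀ s : {s // b s + 2 * δ ≤ d s}, Near δ (b s) (d s) (b' (f s)) (d' (f s)) := by
  classical
  have hne : ∀ φ : line k ⟶ line k, lineScalar φ ≠ 0 → φ ≠ 0 := by
    rintro _ h rfl
    exact h lineScalar_zero
  refine DerivedPersistence.exists_injective_near δ b d b' d'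
    (fun t s => lineScalar (coeff P Q a t s)) (fun s t => lineScalar (coeff Q P c s t))
    (fun t s h => coeff_support P Q a ha hbd t s (hne _ h))
    (fun s t h => coeff_support Q P c hc hbd' s t (hne _ h)) fun s s' h1 h2 => ?_
  simp_rw [← lineScalar_comp]
  rw [← lineScalar_sum, sum_coeff_comp_coeff P Q a ha c hc hac s s' h1 h2]
  split_ifs
  · exact lineScalar_id
  · exact lineScalar_zero

end Coeff

/-! ### From a matching to an interleaving -/

section OfMatching

variable (P : PersistenceBasis M b d) (Q : PersistenceBasis N b' d') (δ : ℕ)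

/-- The family of maps which sends each basis element to its partner. -/
noncomputable def matchingMap (σ : S ≃. T) (x : ℕ) : extendObj M x ⟶ extendObj N (x + δ) :=
  ∑ s, P.coord s x ≫ (σ s).elim 0 fun t => Q.gen t (x + δ)

variable {δ}

/-- Nearness makes this hold even after the death of `s`: from `d' t ≤ d s + δ`, the partner is then
dead at `x + δ` too. -/
lemma gen_matchingMap_of_some (σ : S ≃. T) {s : S} {t : T} (hst : σ s = some t)
    (hn : Near δ (b s) (d s) (b' t) (d' t)) (x : ℕ) (h : b s ≤ x) :
    P.gen s x ≫ matchingMap P Q δ σ x = Q.gen t (x + δ) := by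
  by_cases hx : x ≤ d s
  · rw [matchingMap, P.gen_comp_sum x _ s ⟨h, hx⟩, hst]
    rfl
  · unfold Near at hn
    rw [P.gen_eq_zero s x (fun h => hx h.2), zero_comp, Q.gen_eq_zero t _ (by omega)]

lemma gen_matchingMap_of_none (σ : S ≃. T) {s : S} (hst : σ s = none) (x : ℕ) :
    P.gen s x ≫ matchingMap P Q δ σ x = 0 := by
  by_cases hx : b s ≤ x ∧ x ≤ d s
  · rw [matchingMap, P.gen_comp_sum x _ s hx, hst]
    rfl
  · rw [P.gen_eq_zero s x hx, zero_comp]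

variable (σ : S ≃. T) (hσ : ∀ s t, t ∈ σ s → Near δ (b s) (d s) (b' t) (d' t))

include hσ in
lemma matchingMap_naturality {x y : ℕ} (h : x ≤ y) :
    extendMap M h ≫ matchingMap P Q δ σ y =
      matchingMap P Q δ σ x ≫ extendMap N (Nat.add_le_add_right h δ) := by
  refine P.hom_ext fun s hs => ?_
  rw [← Category.assoc, P.gen_map s h hs.1, ← Category.assoc]
  cases hst : σ s with
  | none => rw [gen_matchingMap_of_none P Q σ hst, gen_matchingMap_of_none P Q σ hst, zero_comp]
  | some t =>
    have hn := hσ s t hst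
    rw [gen_matchingMap_of_some P Q σ hst hn _ (hs.1.trans h),
      gen_matchingMap_of_some P Q σ hst hn _ hs.1, Q.gen_map]
    have := hn.1.1
    omega

-- A matched generator goes to its partner and back. An unmatched bar alive at `x` is dead at `x +
-- 2δ`, being too short, so both sides vanish on it.
include hσ in
lemma matchingMap_comp_symm (hlong : ∀ s, b s + 2 * δ ≤ d s → ∃ t, t ∈ σ s) (x : ℕ) :
    matchingMap P Q δ σ x ≫ matchingMap Q P δ σ.symm (x + δ) =
      extendMap M (show x ≤ x + δ + δ by omega) := by
  refine P.hom_ext fun s hs => ?_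
  rw [P.gen_map s _ hs.1, ← Category.assoc]
  cases hst : σ s with
  | none =>
    rw [gen_matchingMap_of_none P Q σ hst, zero_comp, P.gen_eq_zero]
    intro hs'
    obtain ⟨t, ht⟩ := hlong s (by omega)
    rw [hst] at ht
    cases ht
  | some t =>
    have hn := hσ s t hst
    have hn' := hn
    unfold Near at hn'
    rw [gen_matchingMap_of_some P Q σ hst hn _ hs.1, gen_matchingMap_of_some Q P σ.symm
      ((PEquiv.mem_iff_mem σ).2 hst) ⟨hn.2, hn.1⟩ _ (by omega)]

end OfMatching

end PersistenceBasis

/-- The isometry theorem for representations of `A_n`. -/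
theorem isMatched_iff_exists_isInterleavingPair {M N : Rep k n} {B B' : Barcode n}
    (hM : IsBarcode M B) (hN : IsBarcode N B') (δ : ℕ) :
    IsMatched δ B B' ↔ ∃ (f : M ⟶ (shift n δ).obj N) (g : N ⟶ (shift n δ).obj M),
      IsInterleavingPair δ f g := by
  obtain ⟨P⟩ := hM.nonempty_persistenceBasis
  obtain ⟨Q⟩ := hN.nonempty_persistenceBasis
  have hbd : ∀ I : Interval n, (I.1.1 : ℕ) ≤ I.1.2 := fun I => I.2
  constructor
  · rintro ⟨σ, hσ⟩
    have h1 : ∀ s t, t ∈ σ s → Near δ (s.1.1.1 : ℕ) (s.1.1.2 : ℕ) (t.1.1.1 : ℕ) t.1.1.2 := by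
      intro s t h
      have := hσ.close s t h
      unfold Near
      simp only [Interval.birth, Interval.death] at this
      omega
    have h1' : ∀ t s, s ∈ σ.symm t →
        Near δ (t.1.1.1 : ℕ) (t.1.1.2 : ℕ) (s.1.1.1 : ℕ) s.1.1.2 := fun t s h =>
      ⟨(h1 s t ((PEquiv.mem_iff_mem σ).1 h)).2, (h1 s t ((PEquiv.mem_iff_mem σ).1 h)).1⟩
    refine ⟨shiftHomMk (PersistenceBasis.matchingMap P Q δ σ)
      (PersistenceBasis.matchingMap_naturality P Q σ h1),
      shiftHomMk (PersistenceBasis.matchingMap Q P δ σ.symm)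
      (PersistenceBasis.matchingMap_naturality Q P σ.symm h1'), ?_⟩
    rw [isInterleavingPair_iff]
    simp only [extendShiftHom_mk]
    refine ⟨PersistenceBasis.matchingMap_comp_symm P Q σ h1 fun s hs => hσ.coim s ?_,
      PersistenceBasis.matchingMap_comp_symm Q P σ.symm h1' fun t ht => ?_⟩
    · simp only [Interval.birth, Interval.death]
      omega
    · obtain ⟨s, hs⟩ := hσ.im t (by simp only [Interval.birth, Interval.death]; omega)
      exact ⟨s, (PEquiv.mem_iff_mem σ).2 hs⟩
  · rintro ⟨f, g, h⟩
    rw [isInterleavingPair_iff] at h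
    obtain ⟨u, hu, hun⟩ := PersistenceBasis.exists_injective_near_of_interleaving P Q
      (extendShiftHom f) (extendShiftHom_naturality f) (extendShiftHom g)
      (extendShiftHom_naturality g) (fun s => hbd s.1) (fun t => hbd t.1) h.1
    obtain ⟨v, hv, hvn⟩ := PersistenceBasis.exists_injective_near_of_interleaving Q P
      (extendShiftHom g) (extendShiftHom_naturality g) (extendShiftHom f)
      (extendShiftHom_naturality f) (fun s => hbd s.1) (fun t => hbd t.1) h.2
    -- The injections `u` and `v` each handle the long bars of one side only; since `Near` is
    -- symmetric they combine into a single matching covering both.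
    obtain ⟨σ, h1, h2, h3⟩ := exists_pequiv_covering
      (fun (s : B.Bar) (t : B'.Bar) =>
        Near δ (s.1.1.1 : ℕ) (s.1.1.2 : ℕ) (t.1.1.1 : ℕ) t.1.1.2) u v hu hv hun
      fun t => ⟨(hvn t).2, (hvn t).1⟩
    refine ⟨σ, fun s hs => h1 s ?_, fun t ht => h2 t ?_, fun s t hst => ?_⟩
    · simp only [Interval.birth, Interval.death] at hs
      omega
    · simp only [Interval.birth, Interval.death] at ht
      omega
    · have := h3 s t hst
      unfold Near at this
      simp only [Interval.birth, Interval.death]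
      omega

end Isometry

end DerivedPersistence

namespace DerivedPersistence

universe u

/-! ### Projective resolutions of length one -/

section Projective

variable {k : Type u} [Field k] {n : ℕ}

/-- An interval representation is generated by its element at the birth vertex. -/
lemma intervalRep_hom_ext (I : Interval n) {M : Rep k n} {f g : intervalRep k I ⟶ M}
    (h : intervalGen I I.1.1 ≫ f.app I.1.1 = intervalGen I I.1.1 ≫ g.app I.1.1) : f = g := by
  ext x : 2
  by_cases hx : I.Mem x
  · have h1 : intervalGen I x ≫ f.app x = intervalGen I x ≫ g.app x := by
      rw [← intervalGen_map I (homOfLE hx.1) le_rfl, Category.assoc, Category.assoc,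
        f.naturality, g.naturality, reassoc_of% h]
    rw [← Category.id_comp (f.app x), ← Category.id_comp (g.app x), ← intervalCoord_gen,
      Category.assoc, Category.assoc, h1]
  · exact (isZero_intervalRep_obj I hx).eq_of_src _ _

lemma intervalGen_desc (I : Interval n) {M : Rep k n} (v : line k ⟶ M.obj I.1.1) (hv) :
    intervalGen I I.1.1 ≫ (intervalDesc I v hv).app I.1.1 = v := by
  have h1 : (homOfLE (le_refl I.1.1) : I.1.1 ⟶ I.1.1) = 𝟙 _ := rfl
  simp only [intervalDesc, le_refl, dif_pos, h1, M.map_id, Category.comp_id]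
  rw [reassoc_of% intervalGen_coord (k := k) I ⟨le_refl _, I.2⟩]

lemma exists_line_lift {V W : FGModuleCat.{u} k} (e : V ⟶ W) [Epi e] (w : line k ⟶ W) :
    ∃ v : line k ⟶ V, v ≫ e = w := by
  have : Epi ((forget₂ (FGModuleCat k) (ModuleCat k)).map e) := inferInstance
  obtain ⟨x, hx⟩ := (ModuleCat.epi_iff_surjective _).1 this (w.hom.hom (1 : k))
  refine ⟨FGModuleCat.ofHom (LinearMap.toSpanSingleton k V x),
    FGModuleCat.hom_ext (LinearMap.ext_ring ?_)⟩
  change e.hom.hom (LinearMap.toSpanSingleton k V x 1) = _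
  rw [LinearMap.toSpanSingleton_apply, one_smul]
  exact hx

/-- When the interval reaches the last vertex, its generator never has to die, so morphisms to `M`
correspond to elements of `M_b`, and these lift along epimorphisms. -/
lemma projective_intervalRep (I : Interval n) (hI : ∀ y, y ≤ I.1.2) :
    Projective (intervalRep k I) where
  factors f e _ := by
    obtain ⟨v, hv⟩ := exists_line_lift (e.app I.1.1) (intervalGen I I.1.1 ≫ f.app I.1.1)
    refine ⟨intervalDesc I v fun y _ hy => absurd (hI y) hy, intervalRep_hom_ext I ?_⟩
    rw [NatTrans.comp_app, ← Category.assoc, intervalGen_desc, hv]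

lemma mono_intervalRep_map (I : Interval n) {x y : Fin n} (e : x ⟶ y) (hy : y ≤ I.1.2) :
    Mono ((intervalRep k I).map e) := by
  have : Mono (intervalCoord (k := k) I x) :=
    mono_of_mono_fac (h := 𝟙 _) (intervalCoord_gen I x)
  exact mono_of_mono_fac (intervalMap_coord I e hy)

lemma id_line_ne_zero : (𝟙 (line k) : line k ⟶ line k) ≠ 0 := fun h =>
  one_ne_zero (LinearMap.congr_fun (congrArg (fun g => g.hom.hom) h) (1 : k))

/-- A representation with injective structure maps is projective. -/
lemma projective_of_mono_map (M : Rep k n)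
    (hM : ∀ {x y : Fin n} (e : x ⟶ y), Mono (M.map e)) : Projective M := by
  obtain ⟨T, _, J, i, p, h1, h2, h3⟩ := isIntervalDecomposable M
  -- A summand that dies at some vertex `y` would have a nonzero element killed by an injective
  -- structure map. So all summands reach the last vertex and are projective.
  have hJ : ∀ t y, y ≤ (J t).1.2 := by
    intro t y
    by_contra hy
    have hdy : (J t).1.2 ≤ y := le_of_not_ge hy
    have hd : (J t).Mem (J t).1.2 := ⟨(J t).2, le_rfl⟩
    have hy' : ¬ (J t).Mem y := fun h => hy h.2
    have := hM (homOfLE hdy)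
    have h4 : intervalGen (J t) (J t).1.2 ≫ (i t).app (J t).1.2 = 0 := by
      rw [← cancel_mono (M.map (homOfLE hdy)), Category.assoc, ← (i t).naturality,
        reassoc_of% intervalGen_map (k := k) (J t) (homOfLE hdy) (J t).2,
        intervalGen_of_not_mem (J t) hy', zero_comp,
        zero_comp]
    have h5 : (i t).app (J t).1.2 ≫ (p t).app (J t).1.2 = 𝟙 _ :=
      congrArg (fun g => g.app (J t).1.2) (h1 t)
    apply id_line_ne_zero (k := k)
    rw [← intervalGen_coord (J t) hd, ← Category.id_comp (intervalCoord (J t) _), ← h5,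
      Category.assoc, reassoc_of% h4, zero_comp]
  have := fun t => projective_intervalRep (k := k) (J t) (hJ t)
  refine ⟨fun {E X} f e _ => ⟨∑ t, p t ≫ Projective.factorThru (i t ≫ f) e, ?_⟩⟩
  have h6 : (∑ t, p t ≫ Projective.factorThru (i t ≫ f) e) ≫ e = (∑ t, p t ≫ i t) ≫ f := by
    simp only [Preadditive.sum_comp, Category.assoc, Projective.factorThru_comp]
  rw [h6, h3, Category.id_comp]

/-- `rep_k A_n` is hereditary: every representation has a projective resolution of length
one. -/
theorem exists_projective_resolution (M : Rep k n) :
    ∃ (P₁ P₀ : Rep k n) (a : P₁ ⟶ P₀) (q : P₀ ⟶ M) (w : a ≫ q = 0),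
      Projective P₁ ∧ Projective P₀ ∧ Mono a ∧ Epi q ∧ (ShortComplex.mk a q w).Exact := by
  obtain ⟨T, _, J, i, p, h1, h2, h3⟩ := isIntervalDecomposable M
  -- Any index `t` provides a vertex, hence `n > 0` and `n - 1` is the last vertex. Each `𝕀[b,d]` is
  -- covered by the projective interval from `b` to that vertex.
  have hn : ∀ t, n - 1 < n := fun t => by have := (J t).1.1.2; omega
  let L : T → Interval n := fun t => ⟨((J t).1.1, ⟨n - 1, hn t⟩), by
    change ((J t).1.1 : ℕ) ≤ n - 1
    have := (J t).1.1.2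
    omega⟩
  have hL : ∀ t y, y ≤ (L t).1.2 := fun t y => by
    change (y : ℕ) ≤ n - 1
    have := y.2
    omega
  let r (t : T) : intervalRep k (L t) ⟶ intervalRep k (J t) :=
    intervalDesc (L t) (intervalGen (J t) (J t).1.1) fun y _ hy => absurd (hL t y) hy
  have hr : ∀ t, Epi (r t) := fun t => ⟨fun u v huv => intervalRep_hom_ext _ (by
    have h4 : intervalGen (L t) (L t).1.1 ≫ (r t).app (L t).1.1 =
      intervalGen (k := k) (J t) (J t).1.1 := intervalGen_desc _ _ _
    have h5 : (r t).app (L t).1.1 ≫ u.app (L t).1.1 = (r t).app (L t).1.1 ≫ v.app (L t).1.1 :=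
      congrArg (fun g => g.app (L t).1.1) huv
    rw [← h4, Category.assoc, Category.assoc]
    exact congrArg _ h5)⟩
  let q : (⨁ fun t => intervalRep k (L t)) ⟶ M := biproduct.desc fun t => r t ≫ i t
  have hq : Epi q := ⟨fun u v huv => by
    rw [← Category.id_comp u, ← Category.id_comp v, ← h3, Preadditive.sum_comp,
      Preadditive.sum_comp]
    refine Finset.sum_congr rfl fun t _ => ?_
    have h4 := congrArg (fun g => biproduct.ι (fun t => intervalRep k (L t)) t ≫ g) huv
    simp only [q, biproduct.ι_desc_assoc, Category.assoc, cancel_epi] at h4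
    rw [Category.assoc, Category.assoc, h4]⟩
  have hP : ∀ {x y : Fin n} (e : x ⟶ y), Mono ((⨁ fun t => intervalRep k (L t)).map e) := by
    intro x y e
    refine Preadditive.mono_of_cancel_zero _ fun {G} g hg => ?_
    have h4 : ∀ t, g ≫ (biproduct.π (fun t => intervalRep k (L t)) t).app x = 0 := fun t => by
      have := mono_intervalRep_map (k := k) (L t) e (hL t y)
      rw [← cancel_mono ((intervalRep k (L t)).map e), Category.assoc, ← NatTrans.naturality,
        reassoc_of% hg, zero_comp, zero_comp]
    have h5 : ∑ t, (biproduct.π (fun t => intervalRep k (L t)) t).app x ≫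
        (biproduct.ι (fun t => intervalRep k (L t)) t).app x = 𝟙 _ := by
      have := congrArg (fun g => g.app x) (biproduct.total (f := fun t => intervalRep k (L t)))
      simpa only [NatTrans.app_sum, NatTrans.comp_app, NatTrans.id_app] using this
    rw [← Category.comp_id g, ← h5, Preadditive.comp_sum]
    exact Finset.sum_eq_zero fun t _ => by rw [reassoc_of% h4 t, zero_comp]
  -- The kernel inherits injective structure maps from the cover, which is why the resolution stops
  -- after one step.
  have hK : Projective (kernel q) := projective_of_mono_map _ fun {x y} e => by
    have := hP e
    have : Mono ((kernel q).map e ≫ (kernel.ι q).app y) := by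
      rw [NatTrans.naturality]
      infer_instance
    exact mono_of_mono _ ((kernel.ι q).app y)
  exact ⟨kernel q, _, kernel.ι q, q, kernel.condition q, hK, projective_of_mono_map _ hP,
    inferInstance, hq,
    ShortComplex.exact_of_f_is_kernel _ (kernelIsKernel q)⟩

end Projective

end DerivedPersistence

namespace DerivedPersistence

universe w v u

/-! ### Lifting families of maps between cohomologies to the derived category -/

section Hereditary

variable {C : Type u} [Category.{v} C] [Abelian C]

/-- A family of projective resolutions `0 ⟶ B i ⟶ A (i + 1) ⟶ M (i + 1) ⟶ 0`. -/
structure ResolutionFamily (M : ℤ → C) where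
  /-- The projective objects covering `M`. -/
  A : ℤ → C
  /-- The projective kernels, in their cohomological degrees. -/
  B : ℤ → C
  /-- The inclusions of the kernels. -/
  a (i : ℤ) : B i ⟶ A (i + 1)
  /-- The projections. -/
  q (i : ℤ) : A i ⟶ M i
  w (i : ℤ) : a i ≫ q (i + 1) = 0
  projective_A (i : ℤ) : Projective (A i)
  projective_B (i : ℤ) : Projective (B i)
  mono_a (i : ℤ) : Mono (a i)
  epi_q (i : ℤ) : Epi (q i)
  exact (i : ℤ) : (ShortComplex.mk (a i) (q (i + 1)) (w i)).Exact

namespace ResolutionFamily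

attribute [instance] projective_A projective_B mono_a epi_q

variable {M : ℤ → C} (R : ResolutionFamily M)

/-- The direct sum of the shifted resolutions. -/
noncomputable def complex : CochainComplex C ℤ :=
  CochainComplex.of (fun i => R.A i ⊞ R.B i) (fun i => biprod.snd ≫ R.a i ≫ biprod.inl) (by simp)

lemma complex_d (i : ℤ) :
    R.complex.d i (i + 1) = (biprod.snd : R.A i ⊞ R.B i ⟶ R.B i) ≫ R.a i ≫ biprod.inl :=
  CochainComplex.of_d (fun i => R.A i ⊞ R.B i) (fun i => biprod.snd ≫ R.a i ≫ biprod.inl) i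

/-- The inclusion of `A i` in the complex. -/
noncomputable def inl (i : ℤ) : R.A i ⟶ R.complex.X i := (biprod.inl : R.A i ⟶ R.A i ⊞ R.B i)

/-- The inclusion of `B i` in the complex. -/
noncomputable def inr (i : ℤ) : R.B i ⟶ R.complex.X i := (biprod.inr : R.B i ⟶ R.A i ⊞ R.B i)

/-- The projection of the complex to `A i`. -/
noncomputable def fst (i : ℤ) : R.complex.X i ⟶ R.A i := (biprod.fst : R.A i ⊞ R.B i ⟶ R.A i)

/-- The projection of the complex to `B i`. -/
noncomputable def snd (i : ℤ) : R.complex.X i ⟶ R.B i := (biprod.snd : R.A i ⊞ R.B i ⟶ R.B i)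

lemma d_eq (i : ℤ) : R.complex.d i (i + 1) = R.snd i ≫ R.a i ≫ R.inl (i + 1) := R.complex_d i

lemma inl_snd (i : ℤ) : R.inl i ≫ R.snd i = 0 := biprod.inl_snd

lemma inr_snd (i : ℤ) : R.inr i ≫ R.snd i = 𝟙 _ := biprod.inr_snd

lemma fst_inl_add_snd_inr (i : ℤ) : R.fst i ≫ R.inl i + R.snd i ≫ R.inr i = 𝟙 _ := biprod.total

lemma inl_fst (i : ℤ) : R.inl i ≫ R.fst i = 𝟙 _ := biprod.inl_fst

instance (i : ℤ) : Mono (R.inl i) := mono_of_mono_fac (R.inl_fst i)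

lemma inl_d (i : ℤ) : R.inl i ≫ R.complex.d i (i + 1) = 0 := by
  rw [d_eq, reassoc_of% R.inl_snd, zero_comp]

lemma inr_d (i : ℤ) : R.inr i ≫ R.complex.d i (i + 1) = R.a i ≫ R.inl (i + 1) := by
  rw [d_eq, reassoc_of% R.inr_snd]

lemma hom_ext {i : ℤ} {X : C} {f g : R.complex.X i ⟶ X} (h1 : R.inl i ≫ f = R.inl i ≫ g)
    (h2 : R.inr i ≫ f = R.inr i ≫ g) : f = g := by
  rw [← Category.id_comp f, ← Category.id_comp g, ← fst_inl_add_snd_inr, Preadditive.add_comp,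
    Preadditive.add_comp, Category.assoc, Category.assoc, Category.assoc, Category.assoc, h1, h2]

/-- A morphism of complexes from its components. -/
noncomputable def desc {K : CochainComplex C ℤ} (f : ∀ i, R.A i ⟶ K.X i) (g : ∀ i, R.B i ⟶ K.X i)
    (hf : ∀ i, f i ≫ K.d i (i + 1) = 0) (hg : ∀ i, g i ≫ K.d i (i + 1) = R.a i ≫ f (i + 1)) :
    R.complex ⟶ K where
  f i := R.fst i ≫ f i + R.snd i ≫ g i
  comm' i j hij := by
    obtain rfl : i + 1 = j := hij
    rw [d_eq, Preadditive.add_comp, Category.assoc, Category.assoc, hf, hg, comp_zero, zero_add,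
      Category.assoc, Category.assoc, Preadditive.comp_add, ← Category.assoc (R.inl _), inl_fst,
      reassoc_of% R.inl_snd, Category.id_comp, zero_comp, add_zero]

lemma inl_desc_f {K : CochainComplex C ℤ} (f : ∀ i, R.A i ⟶ K.X i) (g : ∀ i, R.B i ⟶ K.X i)
    (hf hg) (i : ℤ) : R.inl i ≫ (R.desc f g hf hg).f i = f i := by
  change R.inl i ≫ (R.fst i ≫ f i + R.snd i ≫ g i) = f i
  rw [Preadditive.comp_add, ← Category.assoc, inl_fst, reassoc_of% R.inl_snd, Category.id_comp,
    zero_comp, add_zero]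

/-- The cycles of the complex are `A`. -/
noncomputable def toCycles (i : ℤ) : R.A i ⟶ R.complex.cycles i :=
  R.complex.liftCycles (R.inl i) (i + 1) (by simp) (R.inl_d i)

lemma toCycles_i (i : ℤ) : R.toCycles i ≫ R.complex.iCycles i = R.inl i :=
  R.complex.liftCycles_i _ _ _ _

/-- Since `a` and `inl` are monomorphisms, a cycle has zero component in `B i`, so projecting to `A
i` splits the map. -/
instance (i : ℤ) : Epi (R.toCycles i) := by
  have h : R.complex.iCycles i ≫ R.snd i = 0 := by
    rw [← cancel_mono (R.a i ≫ R.inl (i + 1)), Category.assoc, ← d_eq, zero_comp]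
    exact R.complex.iCycles_d i (i + 1)
  refine epi_of_epi_fac (h := 𝟙 _) (f := R.complex.iCycles i ≫ R.fst i) ?_
  rw [← cancel_mono (R.complex.iCycles i), Category.assoc, Category.assoc, toCycles_i,
    Category.id_comp]
  conv_rhs => rw [← Category.comp_id (R.complex.iCycles i), ← fst_inl_add_snd_inr,
    Preadditive.comp_add, reassoc_of% h, zero_comp, add_zero]

lemma a_toCycles_homologyπ (i : ℤ) :
    R.a i ≫ R.toCycles (i + 1) ≫ R.complex.homologyπ (i + 1) = 0 := by
  have h : R.a i ≫ R.toCycles (i + 1) = R.inr i ≫ R.complex.toCycles i (i + 1) := by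
    rw [← cancel_mono (R.complex.iCycles (i + 1)), Category.assoc, Category.assoc, toCycles_i,
      HomologicalComplex.toCycles_i, inr_d]
  rw [reassoc_of% h, HomologicalComplex.toCycles_comp_homologyπ, comp_zero]

/-- `q` is the cokernel of `a`, and `a` lands in boundaries. Only surjectivity is shown; injectivity
comes for free when `exists_hom` is applied to identity maps. -/
lemma exists_toHomology (i : ℤ) : ∃ u : M i ⟶ R.complex.homology i,
    R.q i ≫ u = R.toCycles i ≫ R.complex.homologyπ i ∧ Epi u := by
  obtain ⟨j, rfl⟩ : ∃ j, i = j + 1 := ⟨i - 1, by omega⟩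
  have : Epi (ShortComplex.mk (R.a j) (R.q (j + 1)) (R.w j)).g := R.epi_q (j + 1)
  have h := (R.exact j).gIsCokernel.fac (CokernelCofork.ofπ _ (R.a_toCycles_homologyπ j))
    WalkingParallelPair.one
  refine ⟨_, h, ?_⟩
  have : Epi (R.q (j + 1) ≫ (R.exact j).gIsCokernel.desc
      (CokernelCofork.ofπ _ (R.a_toCycles_homologyπ j))) := by
    rw [show R.q (j + 1) ≫ _ = _ from h]
    exact epi_comp (R.toCycles (j + 1)) (R.complex.homologyπ (j + 1))
  exact epi_of_epi (R.q (j + 1)) _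

/-- The canonical map from `M` to the cohomology of the complex. -/
noncomputable def toHomology (i : ℤ) : M i ⟶ R.complex.homology i := (R.exists_toHomology i).choose

instance (i : ℤ) : Epi (R.toHomology i) := (R.exists_toHomology i).choose_spec.2

lemma q_toHomology (i : ℤ) :
    R.q i ≫ R.toHomology i = R.toCycles i ≫ R.complex.homologyπ i :=
  (R.exists_toHomology i).choose_spec.1

/-- Every family of maps to the cohomology of a complex is induced by a morphism of
complexes. -/
lemma exists_hom (K : CochainComplex C ℤ) (m : ∀ i, M i ⟶ K.homology i) :
    ∃ φ : R.complex ⟶ K, ∀ i, R.toHomology i ≫ HomologicalComplex.homologyMap φ i = m i := by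
  -- Projectivity of `A` lifts `m` to cycles of `K`.
  let z (i : ℤ) : R.A i ⟶ K.cycles i := Projective.factorThru (R.q i ≫ m i) (K.homologyπ i)
  have hz : ∀ i, z i ≫ K.homologyπ i = R.q i ≫ m i := fun i => Projective.factorThru_comp _ _
  -- On `B i` the lifted cycles represent zero because `a ≫ q = 0`, so they are boundaries, and
  -- projectivity of `B` chooses preimages under the differential. These are the remaining
  -- components of the chain map.
  have hg : ∀ i, ∃ g : R.B i ⟶ K.X i, g ≫ K.toCycles i (i + 1) = R.a i ≫ z (i + 1) := fun i => by
    have hex : (ShortComplex.mk (K.toCycles i (i + 1)) (K.homologyπ (i + 1))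
        (K.toCycles_comp_homologyπ i (i + 1))).Exact :=
      ShortComplex.exact_of_g_is_cokernel _ (K.homologyIsCokernel i (i + 1) (by simp))
    have h0 : (R.a i ≫ z (i + 1)) ≫ K.homologyπ (i + 1) = 0 := by
      rw [Category.assoc, hz, ← Category.assoc, R.w, zero_comp]
    exact ⟨hex.liftFromProjective _ h0, hex.liftFromProjective_comp _ h0⟩
  choose g hg using hg
  refine ⟨R.desc (fun i => z i ≫ K.iCycles i) g (fun i => by simp) fun i => ?_, fun i => ?_⟩
  · rw [← HomologicalComplex.toCycles_i, ← Category.assoc, hg, Category.assoc]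
  · rw [← cancel_epi (R.q i), ← Category.assoc, q_toHomology, Category.assoc,
      HomologicalComplex.homologyπ_naturality, ← hz, ← Category.assoc]
    congr 1
    rw [← cancel_mono (K.iCycles i), Category.assoc, HomologicalComplex.cyclesMap_i,
      reassoc_of% R.toCycles_i, inl_desc_f]

end ResolutionFamily

/-- In the derived category of an abelian category in which every object has a projective
resolution of length one, every family of maps between cohomologies is induced by a morphism. -/
theorem exists_derived_hom [HasDerivedCategory.{w} C]
    (hC : ∀ M : C, ∃ (P₁ P₀ : C) (a : P₁ ⟶ P₀) (q : P₀ ⟶ M) (w : a ≫ q = 0),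
      Projective P₁ ∧ Projective P₀ ∧ Mono a ∧ Epi q ∧ (ShortComplex.mk a q w).Exact)
    (X Z : DerivedCategory C)
    (m : ∀ i, (DerivedCategory.homologyFunctor C i).obj X ⟶
      (DerivedCategory.homologyFunctor C i).obj Z) :
    ∃ f : X ⟶ Z, ∀ i, (DerivedCategory.homologyFunctor C i).map f = m i := by
  let H := DerivedCategory.homologyFunctor C
  have hs := Localization.essSurj DerivedCategory.Q (HomologicalComplex.quasiIso C (.up ℤ))
  let K := DerivedCategory.Q.objPreimage X
  let L := DerivedCategory.Q.objPreimage Z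
  let eK : DerivedCategory.Q.obj K ≅ X := DerivedCategory.Q.objObjPreimageIso X
  let eL : DerivedCategory.Q.obj L ≅ Z := DerivedCategory.Q.objObjPreimageIso Z
  let F (i : ℤ) (K : CochainComplex C ℤ) : (H i).obj (DerivedCategory.Q.obj K) ≅ K.homology i :=
    (DerivedCategory.homologyFunctorFactors C i).app K
  have hF : ∀ (i : ℤ) {K L : CochainComplex C ℤ} (f : K ⟶ L),
      (H i).map (DerivedCategory.Q.map f) ≫ (F i L).hom =
        (F i K).hom ≫ HomologicalComplex.homologyMap f i :=
    fun i _ _ f => DerivedCategory.homologyFunctorFactors_hom_naturality f i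
  choose P₁ P₀ a q w h1 h2 h3 h4 h5 using fun i => hC (K.homology i)
  let R : ResolutionFamily (fun i => K.homology i) :=
    { A := P₀
      -- The kernel belonging to cohomology in degree `i + 1` sits one degree lower, so that its
      -- inclusion is part of the differential.
      B := fun i => P₁ (i + 1)
      a := fun i => a (i + 1)
      q := q
      w := fun i => w (i + 1)
      projective_A := h2
      projective_B := fun i => h1 (i + 1)
      mono_a := fun i => h3 (i + 1)
      epi_q := h4
      exact := fun i => h5 (i + 1) }
  let m' (i : ℤ) : K.homology i ⟶ L.homology i :=
    (F i K).inv ≫ (H i).map eK.hom ≫ m i ≫ (H i).map eL.inv ≫ (F i L).hom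
  -- The identities of the cohomologies are realised by `φ`; this makes `toHomology` a split
  -- monomorphism as well as an epimorphism, so `φ` is a quasi-isomorphism. The desired morphism is
  -- the roof formed by `φ` and `ψ`.
  obtain ⟨φ, hφ⟩ := R.exists_hom K fun i => 𝟙 _
  obtain ⟨ψ, hψ⟩ := R.exists_hom L m'
  have hiso : ∀ i, IsIso (HomologicalComplex.homologyMap φ i) := fun i => by
    have : IsSplitMono (R.toHomology i) := ⟨⟨_, hφ i⟩⟩
    have : IsIso (R.toHomology i) := isIso_of_epi_of_isSplitMono _
    have : IsIso (R.toHomology i ≫ HomologicalComplex.homologyMap φ i) := by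
      rw [hφ]
      infer_instance
    exact IsIso.of_isIso_comp_left (R.toHomology i) _
  have hq : QuasiIso φ := ⟨fun i => by
    rw [quasiIsoAt_iff_isIso_homologyMap]
    exact hiso i⟩
  have : IsIso (DerivedCategory.Q.map φ) := (DerivedCategory.isIso_Q_map_iff_quasiIso _ φ).2 hq
  have hm : ∀ i, HomologicalComplex.homologyMap φ i ≫ m' i = HomologicalComplex.homologyMap ψ i :=
    fun i => by
      rw [← cancel_epi (R.toHomology i), ← Category.assoc, hφ, Category.id_comp, hψ]
  refine ⟨eK.inv ≫ inv (DerivedCategory.Q.map φ) ≫ DerivedCategory.Q.map ψ ≫ eL.hom, fun i => ?_⟩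
  have h6 : (H i).map (DerivedCategory.Q.map ψ) =
      (H i).map (DerivedCategory.Q.map φ) ≫ (H i).map eK.hom ≫ m i ≫ (H i).map eL.inv := by
    rw [← cancel_mono ((F i L).hom), hF, ← hm, ← reassoc_of% hF i φ]
    simp [m']
  rw [Functor.map_comp, Functor.map_comp, Functor.map_comp, h6]
  simp only [Category.assoc, ← Functor.map_comp_assoc]
  simp [H]

end Hereditary

end DerivedPersistence

namespace DerivedPersistence

universe w u

/-! ### The derived isometry theorem -/

section Derived

variable {k : Type u} [Field k] {n : ℕ} [HasDerivedCategory.{w} (Rep k n)]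

/-- Families of maps `H^i(X) ⟶ H^i(Y)(δ)` are induced by maps `X ⟶ Y(δ)`. -/
lemma exists_cohomologyMap_eq (δ : ℕ) (X Y : DerivedCategory.Bounded (Rep k n))
    (m : ∀ i, (cohomology (Rep k n) i).obj X ⟶
      (shift n δ).obj ((cohomology (Rep k n) i).obj Y)) :
    ∃ f : X ⟶ (mapBounded (shift n δ)).obj Y, ∀ i, cohomologyMap (shift n δ) f i = m i := by
  let e (i : ℤ) : (DerivedCategory.homologyFunctor (Rep k n) i).obj
      ((mapBounded (shift n δ)).obj Y).obj ≅ (shift n δ).obj ((cohomology (Rep k n) i).obj Y) :=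
    (homologyMapDerivedIso (shift n δ) i).app Y.obj
  -- A morphism in the unbounded derived category suffices, the bounded one being a full
  -- subcategory. The prescribed maps are first corrected by the identification of `H^i(Y(δ))` with
  -- `H^i(Y)(δ)`.
  obtain ⟨f, hf⟩ := exists_derived_hom exists_projective_resolution X.obj
    ((mapBounded (shift n δ)).obj Y).obj fun i => m i ≫ (e i).inv
  exact ⟨ObjectProperty.homMk f, fun i => (congrArg (fun g => g ≫ (e i).hom) (hf i)).trans
    ((Category.assoc _ _ _).trans ((congrArg _ (e i).inv_hom_id).trans (Category.comp_id _)))⟩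

/-- The derived isometry theorem: `δ`-matched derived barcodes are the same as derived
`δ`-interleavings. -/
theorem isDerivedMatched_iff_isDerivedInterleaved (δ : ℕ)
    (X Y : DerivedCategory.Bounded (Rep k n)) :
    IsDerivedMatched δ (derivedBarcode X) (derivedBarcode Y) ↔ IsDerivedInterleaved δ X Y := by
  have key := fun i => isMatched_iff_exists_isInterleavingPair
    (isBarcode_barcode ((cohomology (Rep k n) i).obj X))
    (isBarcode_barcode ((cohomology (Rep k n) i).obj Y)) δ
  constructor
  · intro h
    -- The degrees do not interact: interleaving pairs are chosen separately for each `i`, then each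
    -- family is lifted at once.
    choose f g hfg using fun i => (key i).1 (h i)
    obtain ⟨F, hF⟩ := exists_cohomologyMap_eq δ X Y f
    obtain ⟨G, hG⟩ := exists_cohomologyMap_eq δ Y X g
    refine ⟨F, G, fun i => ?_⟩
    rw [hF, hG]
    exact hfg i
  · rintro ⟨f, g, h⟩ i
    exact (key i).2 ⟨_, _, h i⟩

end Derived

end DerivedPersistence

universe w₁ w₂ v₁ u₁ u

open DerivedPersistence in
theorem corollary5p3 {k : Type u} [Field k] (n : ℕ)
    {A : Type u₁} [Category.{v₁} A] [Abelian A] [HasDerivedCategory.{w₁} A]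
    [HasDerivedCategory.{w₂} (Rep k n)]
    (E : DerivedCategory.Bounded A ⥤ DerivedCategory.Bounded (Rep k n))
    [E.CommShift ℤ] [E.IsTriangulated] [E.IsEquivalence] :
    (∀ X Y : DerivedCategory.Bounded A,
      bottleneckDistWrt E X Y = interleavingDistWrt E X Y) ∧
    (∀ X Y : A,
      bottleneckDistWrt E ((stalk A).obj X) ((stalk A).obj Y) =
        interleavingDistWrt E ((stalk A).obj X) ((stalk A).obj Y)) := by
  -- Both infima range over the same `δ`, by the derived isometry theorem for `E(X)` and `E(Y)`.
  have key : ∀ X Y : DerivedCategory.Bounded A,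
      bottleneckDistWrt E X Y = interleavingDistWrt E X Y := fun X Y =>
    iInf_congr fun δ => iInf_congr_Prop
      (isDerivedMatched_iff_isDerivedInterleaved δ (E.obj X) (E.obj Y)) fun _ => rfl
  exact ⟨key, fun X Y => key _ _⟩
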